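/- Let $r>0$, $r\neq 1$, $b>0$, let $d\ge 1$, and consider the (non-delayed) Belousov--Zhabotinsky system $$u_t=\Delta u+u(1-u-rv),\qquad v_t=\Delta v-buv,\qquad t\in\mathbb{R},\ x\in\mathbb{R}^d.$$ A monotone wavefront of speed $c\in\mathbb{R}$ in the direction $\nu\in\mathbb{R}^d$, $|\nu|=1$, is a classical solution of the form $(u,v)(t,x)=(\phi,\theta)(\nu\cdot x+ct)$ whose profile $(\phi,\theta)$ has positive components, $\phi$ non-decreasing and $\theta$ non-increasing, and connects the equilibria $(0,1)$ and $(1,0)$: $(\phi,\theta)(-\infty)=(0,1)$, $(\phi,\theta)(+\infty)=(1,0)$. The speed $c$ is called admissible if a monotone wavefront of speed $c$ exists. For each admissible speed $c$, the monotone wavefront of speed $c$ is unique up to translation: there is a pair $(\phi_0,\theta_0)$ of functions on $\mathbb{R}$ such that, for every unit vector $\nu\in\mathbb{R}^d$, a pair $(\phi,\theta)$ is the profile of a monotone wavefront of speed $c$ in the direction $\nu$ if and only if there is $s\in\mathbb{R}$ with $(\phi,\theta)(\xi)=(\phi_0,\theta_0)(\xi+s)$ for all $\xi\in\mathbb{R}$.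 -/

import Mathlib

open Filter Topology Laplacian

/-- `(u, v)`, functions of time `t ∈ ℝ` and space `x ∈ ℝᵈ`, is a classical solution of the
(non-delayed) Belousov-Zhabotinsky system
`u_t = Δu + u (1 - u - r v)`, `v_t = Δv - b u v`. The Laplacian acts on the space variable. -/
structure IsBZSolution (d : ℕ) (r b : ℝ) (u v : ℝ → EuclideanSpace ℝ (Fin d) → ℝ) : Prop where
  diff_time_u : ∀ x, Differentiable ℝ (fun t => u t x)
  diff_time_v : ∀ x, Differentiable ℝ (fun t => v t x)
  contDiff_space_u : ∀ t, ContDiff ℝ 2 (u t)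
  contDiff_space_v : ∀ t, ContDiff ℝ 2 (v t)
  eq_u : ∀ t x, deriv (fun s => u s x) t = Δ (u t) x + u t x * (1 - u t x - r * v t x)
  eq_v : ∀ t x, deriv (fun s => v s x) t = Δ (v t) x - b * u t x * v t x

/-- `(φ, θ)` is the profile of a (positive, componentwise) monotone wavefront
`(u, v)(t, x) = (φ, θ)(ν · x + c t)`, `|ν| = 1`, of the Belousov-Zhabotinsky system, of speed `c`
and direction `ν`, connecting the equilibria `(0, 1)` and `(1, 0)`. -/
structure IsMonotoneWavefront (d : ℕ) (r b c : ℝ) (ν : EuclideanSpace ℝ (Fin d))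
    (φ θ : ℝ → ℝ) : Prop where
  norm_direction : ‖ν‖ = 1
  solution : IsBZSolution d r b
    (fun t x => φ (inner ℝ ν x + c * t)) (fun t x => θ (inner ℝ ν x + c * t))
  pos_φ : ∀ ξ, 0 < φ ξ
  pos_θ : ∀ ξ, 0 < θ ξ
  monotone_φ : Monotone φ
  antitone_θ : Antitone θ
  tendsto_φ_atBot : Tendsto φ atBot (𝓝 0)
  tendsto_θ_atBot : Tendsto θ atBot (𝓝 1)
  tendsto_φ_atTop : Tendsto φ atTop (𝓝 1)
  tendsto_θ_atTop : Tendsto θ atTop (𝓝 0)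

/-- `c` is an admissible wave speed: some monotone wavefront propagates with speed `c`. -/
def IsAdmissibleSpeed (d : ℕ) (r b c : ℝ) : Prop :=
  ∃ (ν : EuclideanSpace ℝ (Fin d)) (φ θ : ℝ → ℝ), IsMonotoneWavefront d r b c ν φ θ

/-! A plane wave solves the PDE system exactly when its profile solves an autonomous ODE system in
which the direction does not appear. So everything reduces to two profiles of the same speed `c`,
and it must be shown that they are translates of each other.

The system is monotone once the order on the second component is reversed, so the sliding method
applies. If the translates of `φ₁` by every shift larger than `s₀` dominate `φ₂` near `-∞`, then
`sliding` gives the order of both components on the whole line. Near `+∞` the order follows from a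
weighted maximum principle (`le_on_Ici`). Near `-∞` the order of `φ` forces that of `θ`
(`θ_le_on_Iic`). In between, compactness and the strong comparison principle `eq_or_lt` allow the
shift to be lowered. Thus only the behaviour of `φ` at `-∞` matters.

That behaviour is read off the Riccati equation of `φ'/φ`. This quotient is bounded and tends to a
root `L` of `L² - cL + 1 - r = 0`; since `r ≠ 1`, the root is not zero and hence positive
(`exists_decay_rate`). For two profiles with the same `L`, the Wronskian weighted by `e^{-ct}` is a
constant up to an exponential error, and the sign of the constant makes `φ₁/φ₂` or `φ₂/φ₁` converge
(`ratio_tendsto_of_same_rate`). With distinct rates one of the ratios tends to `0`.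

A ratio with limit `0` is impossible, since sliding would then place one profile below all
translates of the other (`not_ratio_tendsto_zero`). If the limit is `Λ > 0`, sliding in both
directions down to the shift `-log Λ / L` yields opposite inequalities, hence equality
(`translate_of_ratio_tendsto`). -/

/-- The wave profile equations in first order form: `φ'' = c φ' - φ (1 - φ - r θ)` and
`θ'' = c θ' + b φ θ`, together with positivity, monotonicity and the boundary values of a front. -/
structure IsWaveProfile (r b c : ℝ) (φ dφ θ dθ : ℝ → ℝ) : Prop where
  deriv_φ : ∀ x, HasDerivAt φ (dφ x) x
  deriv_dφ : ∀ x, HasDerivAt dφ (c * dφ x - φ x * (1 - φ x - r * θ x)) x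
  deriv_θ : ∀ x, HasDerivAt θ (dθ x) x
  deriv_dθ : ∀ x, HasDerivAt dθ (c * dθ x + b * φ x * θ x) x
  pos_φ : ∀ ξ, 0 < φ ξ
  pos_θ : ∀ ξ, 0 < θ ξ
  mono_φ : Monotone φ
  anti_θ : Antitone θ
  φ_bot : Tendsto φ atBot (𝓝 0)
  θ_bot : Tendsto θ atBot (𝓝 1)
  φ_top : Tendsto φ atTop (𝓝 1)
  θ_top : Tendsto θ atTop (𝓝 0)

/-! ### Plane waves: from the PDE system to the profile equations and back. -/

section PlaneWaves

variable {d : ℕ} {ν : EuclideanSpace ℝ (Fin d)}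

theorem iteratedDeriv_two_eq {f : ℝ → ℝ} : iteratedDeriv 2 f = deriv (deriv f) := by
  rw [iteratedDeriv_succ, iteratedDeriv_one]

/-- The Laplacian of a plane function is its second derivative along the direction. -/
theorem laplacian_planeWave (hν : ‖ν‖ = 1) {f : ℝ → ℝ} (hf : ContDiff ℝ 2 f) (a : ℝ)
    (x : EuclideanSpace ℝ (Fin d)) :
    Δ (fun y : EuclideanSpace ℝ (Fin d) => f (inner ℝ ν y + a)) x
      = deriv (deriv f) (inner ℝ ν x + a) := by
  have hg : ContDiff ℝ 2 (fun y => f (y + a)) := hf.comp (contDiff_id.add contDiff_const)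
  have hcomp : (fun y : EuclideanSpace ℝ (Fin d) => f (inner ℝ ν y + a))
      = (fun y => f (y + a)) ∘ (innerSL ℝ ν) := by
    ext y; simp
  have hparseval := (EuclideanSpace.basisFun (Fin d) ℝ).sum_sq_norm_inner_left ν
  rw [hcomp, InnerProductSpace.laplacian_eq_iteratedFDeriv_orthonormalBasis _
    (EuclideanSpace.basisFun (Fin d) ℝ)]
  simp only
  rw [ContinuousLinearMap.iteratedFDeriv_comp_right _ hg x le_rfl]
  -- The Hessian of the plane function is `f''` times `ν ⊗ ν`; its trace is `f'' ‖ν‖²` by Parseval.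
  have key : ∀ i, ((iteratedFDeriv ℝ 2 (fun y => f (y + a)) ((innerSL ℝ ν) x)).compContinuousLinearMap
      fun _ => innerSL ℝ ν) ![EuclideanSpace.basisFun (Fin d) ℝ i, EuclideanSpace.basisFun (Fin d) ℝ i]
      = ‖inner ℝ ν (EuclideanSpace.basisFun (Fin d) ℝ i)‖ ^ 2 *
        deriv (deriv f) (inner ℝ ν x + a) := by
    intro i
    rw [ContinuousMultilinearMap.compContinuousLinearMap_apply,
      iteratedFDeriv_apply_eq_iteratedDeriv_mul_prod, iteratedDeriv_comp_add_const,
      iteratedDeriv_two_eq]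
    simp [Fin.prod_univ_two, sq]
  rw [Finset.sum_congr rfl fun i _ => key i, ← Finset.sum_mul, hparseval, hν]
  simp

/-- Restriction to the line spanned by `ν` recovers `f`, because `⟪ν, y • ν⟫ = y`. -/
theorem contDiff_of_planeWave (hν : ‖ν‖ = 1) {f : ℝ → ℝ}
    (hf : ContDiff ℝ 2 (fun y : EuclideanSpace ℝ (Fin d) => f (inner ℝ ν y))) :
    ContDiff ℝ 2 f := by
  have h : f = (fun y : EuclideanSpace ℝ (Fin d) => f (inner ℝ ν y)) ∘ fun y : ℝ => y • ν := by
    ext y; simp [inner_smul_right, hν]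
  rw [h]
  exact hf.comp (contDiff_id.smul contDiff_const)

theorem deriv_planeWave_time {f : ℝ → ℝ} (hf : Differentiable ℝ f) (a c t : ℝ) :
    HasDerivAt (fun s => f (a + c * s)) (c * deriv f (a + c * t)) t := by
  have h1 : HasDerivAt (fun s => a + c * s) c t := by
    simpa using ((hasDerivAt_id t).const_mul c).const_add a
  exact ((hf (a + c * t)).hasDerivAt.comp t h1).congr_deriv (mul_comm _ _)

theorem IsMonotoneWavefront.isWaveProfile {r b c : ℝ} {φ θ : ℝ → ℝ}
    (h : IsMonotoneWavefront d r b c ν φ θ) :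
    IsWaveProfile r b c φ (deriv φ) θ (deriv θ) := by
  have hν := h.norm_direction
  have hφ : ContDiff ℝ 2 φ := contDiff_of_planeWave hν (by
    simpa using h.solution.contDiff_space_u 0)
  have hθ : ContDiff ℝ 2 θ := contDiff_of_planeWave hν (by
    simpa using h.solution.contDiff_space_v 0)
  have hφ1 : Differentiable ℝ φ := hφ.differentiable (by norm_num)
  have hθ1 : Differentiable ℝ θ := hθ.differentiable (by norm_num)
  have hφ2 : Differentiable ℝ (deriv φ) :=
    ((contDiff_succ_iff_deriv (n := 1)).1 hφ).2.2.differentiable (by norm_num)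
  have hθ2 : Differentiable ℝ (deriv θ) :=
    ((contDiff_succ_iff_deriv (n := 1)).1 hθ).2.2.differentiable (by norm_num)
  have hy : ∀ y : ℝ, inner ℝ ν (y • ν) = y := fun y => by simp [inner_smul_right, hν]
  refine ⟨fun x => (hφ1 x).hasDerivAt, fun x => ?_, fun x => (hθ1 x).hasDerivAt, fun x => ?_,
    h.pos_φ, h.pos_θ, h.monotone_φ, h.antitone_θ, h.tendsto_φ_atBot, h.tendsto_θ_atBot,
    h.tendsto_φ_atTop, h.tendsto_θ_atTop⟩
  · have e := h.solution.eq_u 0 (x • ν)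
    rw [(deriv_planeWave_time hφ1 _ c 0).deriv, laplacian_planeWave hν hφ] at e
    simp only [hy, mul_zero, add_zero] at e
    exact (hφ2 x).hasDerivAt.congr_deriv (by linarith)
  · have e := h.solution.eq_v 0 (x • ν)
    rw [(deriv_planeWave_time hθ1 _ c 0).deriv, laplacian_planeWave hν hθ] at e
    simp only [hy, mul_zero, add_zero] at e
    exact (hθ2 x).hasDerivAt.congr_deriv (by linarith)

theorem contDiff_two_of_hasDerivAt {f df ddf : ℝ → ℝ} (h1 : ∀ x, HasDerivAt f (df x) x)
    (h2 : ∀ x, HasDerivAt df (ddf x) x) (h3 : Continuous ddf) : ContDiff ℝ 2 f := by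
  have e1 : deriv f = df := funext fun x => (h1 x).deriv
  have e2 : deriv df = ddf := funext fun x => (h2 x).deriv
  refine (contDiff_succ_iff_deriv (n := 1)).2 ⟨fun x => (h1 x).differentiableAt, by simp, ?_⟩
  rw [e1]
  exact contDiff_one_iff_deriv.2 ⟨fun x => (h2 x).differentiableAt, by rwa [e2]⟩

theorem IsWaveProfile.isMonotoneWavefront {r b c : ℝ} {φ dφ θ dθ : ℝ → ℝ}
    (h : IsWaveProfile r b c φ dφ θ dθ) (hν : ‖ν‖ = 1) :
    IsMonotoneWavefront d r b c ν φ θ := by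
  have cφ : Continuous φ := continuous_iff_continuousAt.2 fun x => (h.deriv_φ x).continuousAt
  have cdφ : Continuous dφ := continuous_iff_continuousAt.2 fun x => (h.deriv_dφ x).continuousAt
  have cθ : Continuous θ := continuous_iff_continuousAt.2 fun x => (h.deriv_θ x).continuousAt
  have cdθ : Continuous dθ := continuous_iff_continuousAt.2 fun x => (h.deriv_dθ x).continuousAt
  have hφ : ContDiff ℝ 2 φ := contDiff_two_of_hasDerivAt h.deriv_φ h.deriv_dφ (by fun_prop)
  have hθ : ContDiff ℝ 2 θ := contDiff_two_of_hasDerivAt h.deriv_θ h.deriv_dθ (by fun_prop)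
  have hφ1 : Differentiable ℝ φ := fun x => (h.deriv_φ x).differentiableAt
  have hθ1 : Differentiable ℝ θ := fun x => (h.deriv_θ x).differentiableAt
  have e1 : deriv φ = dφ := funext fun x => (h.deriv_φ x).deriv
  have e2 : deriv θ = dθ := funext fun x => (h.deriv_θ x).deriv
  have hsp : ∀ t : ℝ, ContDiff ℝ 2
      (fun x : EuclideanSpace ℝ (Fin d) => inner ℝ ν x + c * t) := fun t =>
    (contDiff_const.inner ℝ contDiff_id).add contDiff_const
  refine ⟨hν, ⟨fun x t => (deriv_planeWave_time hφ1 _ c t).differentiableAt,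
    fun x t => (deriv_planeWave_time hθ1 _ c t).differentiableAt,
    fun t => hφ.comp (hsp t), fun t => hθ.comp (hsp t), fun t x => ?_, fun t x => ?_⟩,
    h.pos_φ, h.pos_θ, h.mono_φ, h.anti_θ, h.φ_bot, h.θ_bot, h.φ_top, h.θ_top⟩
  · rw [(deriv_planeWave_time hφ1 _ c t).deriv, laplacian_planeWave hν hφ, e1,
      (h.deriv_dφ _).deriv]
    ring
  · rw [(deriv_planeWave_time hθ1 _ c t).deriv, laplacian_planeWave hν hθ, e2,
      (h.deriv_dθ _).deriv]
    ring

end PlaneWaves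

theorem IsWaveProfile.shift {r b c : ℝ} {φ dφ θ dθ : ℝ → ℝ}
    (h : IsWaveProfile r b c φ dφ θ dθ) (s : ℝ) :
    IsWaveProfile r b c (fun x => φ (x + s)) (fun x => dφ (x + s)) (fun x => θ (x + s))
      (fun x => dθ (x + s)) where
  deriv_φ x := (h.deriv_φ (x + s)).comp_add_const x s
  deriv_dφ x := (h.deriv_dφ (x + s)).comp_add_const x s
  deriv_θ x := (h.deriv_θ (x + s)).comp_add_const x s
  deriv_dθ x := (h.deriv_dθ (x + s)).comp_add_const x s
  pos_φ _ := h.pos_φ _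
  pos_θ _ := h.pos_θ _
  mono_φ _ _ hxy := h.mono_φ (by linarith)
  anti_θ _ _ hxy := h.anti_θ (by linarith)
  φ_bot := h.φ_bot.comp (tendsto_atBot_add_const_right _ _ tendsto_id)
  θ_bot := h.θ_bot.comp (tendsto_atBot_add_const_right _ _ tendsto_id)
  φ_top := h.φ_top.comp (tendsto_atTop_add_const_right _ _ tendsto_id)
  θ_top := h.θ_top.comp (tendsto_atTop_add_const_right _ _ tendsto_id)

/-! ### Maximum principles on the line. -/

/-- A negative second derivative would make the point a local maximum as well, so `f` would be
locally constant and the second derivative would vanish. -/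
theorem second_deriv_nonneg_of_isLocalMin {f df : ℝ → ℝ} {a x : ℝ}
    (hf : ∀ y, HasDerivAt f (df y) y) (hdf : HasDerivAt df a x) (hx : IsLocalMin f x) : 0 ≤ a := by
  by_contra! ha
  have e1 : deriv f = df := funext fun y => (hf y).deriv
  have h0 : df x = 0 := hx.hasDerivAt_eq_zero (hf x)
  have hmax : IsLocalMax f x := isLocalMax_of_deriv_deriv_neg (by rw [e1, hdf.deriv]; exact ha)
    (by rw [e1, h0]) (hf x).continuousAt
  have hconst : f =ᶠ[𝓝 x] fun _ => f x := by
    filter_upwards [hx, hmax] with y h1 h2 using le_antisymm h2 h1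
  have h1 : deriv f =ᶠ[𝓝 x] deriv fun _ => f x := hconst.deriv
  have h2 := h1.deriv_eq
  rw [e1, hdf.deriv] at h2
  simp at h2
  linarith

/-- A negative value beats the tail, which tends to `0`, so the minimum is found on a compact
interval; it is not at `T`, where `f` is nonnegative. -/
theorem exists_interior_min_Ici {f : ℝ → ℝ} (hf : Continuous f) (hlim : Tendsto f atTop (𝓝 0))
    {T x : ℝ} (hT : 0 ≤ f T) (hTx : T ≤ x) (hx : f x < 0) :
    ∃ y, T < y ∧ f y < 0 ∧ ∀ z, T ≤ z → f y ≤ f z := by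
  obtain ⟨N, hN⟩ := eventually_atTop.1 (hlim.eventually_const_lt hx)
  obtain ⟨y, hy, hmin⟩ := isCompact_Icc.exists_isMinOn (s := Set.Icc T (max N x))
    ⟨x, hTx, le_max_right _ _⟩ hf.continuousOn
  have hyx : f y ≤ f x := hmin ⟨hTx, le_max_right _ _⟩
  refine ⟨y, lt_of_le_of_ne hy.1 ?_, by linarith, fun z hz => ?_⟩
  · rintro rfl; linarith
  · rcases le_total z (max N x) with h | h
    · exact hmin ⟨hz, h⟩
    · exact hyx.trans (hN z ((le_max_left _ _).trans h)).le

theorem exists_interior_min_Iic {f : ℝ → ℝ} (hf : Continuous f) (hlim : Tendsto f atBot (𝓝 0))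
    {T x : ℝ} (hT : 0 ≤ f T) (hTx : x ≤ T) (hx : f x < 0) :
    ∃ y, y < T ∧ f y < 0 ∧ ∀ z, z ≤ T → f y ≤ f z := by
  obtain ⟨y, h1, h2, h3⟩ := exists_interior_min_Ici (f := fun x => f (-x)) (T := -T) (x := -x)
    (hf.comp continuous_neg) (hlim.comp tendsto_neg_atTop_atBot) (by simpa using hT)
    (by linarith) (by simpa using hx)
  exact ⟨-y, by linarith, h2, fun z hz => by simpa using h3 (-z) (by linarith)⟩

/-- A nonnegative supersolution of `p'' - c p' - N p = 0` that vanishes at a point vanishes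
identically. -/
theorem eq_zero_of_nonneg_supersolution {p dp ddp : ℝ → ℝ} {c N x₀ : ℝ}
    (hp : ∀ x, HasDerivAt p (dp x) x) (hdp : ∀ x, HasDerivAt dp (ddp x) x)
    (hnn : ∀ x, 0 ≤ p x) (hsup : ∀ x, ddp x - c * dp x - N * p x ≤ 0) (h0 : p x₀ = 0) (x : ℝ) :
    p x = 0 := by
  obtain ⟨α, hα, hαN⟩ : ∃ α : ℝ, 0 < α ∧ N ≤ α * (α - c) := by
    refine ⟨|c| + |N| + 1, by positivity, ?_⟩
    have h1 := le_abs_self c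
    have h2 := le_abs_self N
    nlinarith [abs_nonneg c, abs_nonneg N]
  have hdp0 : dp x₀ = 0 := by
    refine IsLocalMin.hasDerivAt_eq_zero ?_ (hp x₀)
    exact Eventually.of_forall fun y => by rw [h0]; exact hnn y
  -- The operator is compared with `(D - β)(D - γ)`, where `β + γ = c` and `-βγ ≥ N`; the excess in
  -- the zeroth order term has the right sign because `p ≥ 0`. As `p` and `p'` both vanish at `x₀`,
  -- two successive first order inequalities give `p ≤ 0` on each side.
  have factor : ∀ β γ : ℝ, β + γ = c → N ≤ -(β * γ) →
      Antitone fun x => Real.exp (-β * x) * (dp x - γ * p x) := by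
    intro β γ hc hN
    have hd : ∀ x, HasDerivAt (fun x => Real.exp (-β * x) * (dp x - γ * p x))
        (Real.exp (-β * x) * (ddp x - c * dp x + β * γ * p x)) x := by
      intro x
      have he : HasDerivAt (fun x => Real.exp (-β * x)) (Real.exp (-β * x) * (-β)) x := by
        simpa using ((hasDerivAt_id x).const_mul (-β)).exp
      refine (he.mul ((hdp x).sub ((hp x).const_mul γ))).congr_deriv ?_
      simp only [Pi.sub_apply, ← hc]; ring
    refine antitone_of_hasDerivAt_nonpos hd fun x => ?_
    refine mul_nonpos_of_nonneg_of_nonpos (Real.exp_pos _).le ?_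
    nlinarith [hsup x, hnn x]
  have conclude : ∀ γ : ℝ, ∀ x, HasDerivAt (fun x => Real.exp (-γ * x) * p x)
      (Real.exp (-γ * x) * (dp x - γ * p x)) x := by
    intro γ x
    have he : HasDerivAt (fun x => Real.exp (-γ * x)) (Real.exp (-γ * x) * (-γ)) x := by
      simpa using ((hasDerivAt_id x).const_mul (-γ)).exp
    exact (he.mul (hp x)).congr_deriv (by ring)
  have hcont : ∀ γ : ℝ, Continuous (fun x => Real.exp (-γ * x) * p x) := fun γ =>
    continuous_iff_continuousAt.2 fun x => (conclude γ x).continuousAt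
  refine le_antisymm ?_ (hnn x)
  rcases le_total x₀ x with hx | hx
  · have hanti := factor α (c - α) (by ring) (by linarith)
    have h := antitoneOn_of_hasDerivWithinAt_nonpos (convex_Ici x₀) (hcont (c - α)).continuousOn
      (fun y _ => (conclude (c - α) y).hasDerivWithinAt) (fun y hy => by
        rw [interior_Ici] at hy
        have := hanti (le_of_lt hy)
        simp only [h0, hdp0, mul_zero, sub_zero] at this
        exact mul_nonpos_of_nonneg_of_nonpos (Real.exp_pos _).le
          (nonpos_of_mul_nonpos_right this (Real.exp_pos _)))
    have := h (Set.self_mem_Ici) hx hx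
    simp only [h0, mul_zero] at this
    exact nonpos_of_mul_nonpos_right this (Real.exp_pos _)
  · have hanti := factor (c - α) α (by ring) (by linarith)
    have h := monotoneOn_of_hasDerivWithinAt_nonneg (convex_Iic x₀) (hcont α).continuousOn
      (fun y _ => (conclude α y).hasDerivWithinAt) (fun y hy => by
        rw [interior_Iic] at hy
        have := hanti (le_of_lt hy)
        simp only [h0, hdp0, mul_zero, sub_zero] at this
        exact mul_nonneg (Real.exp_pos _).le
          (nonneg_of_mul_nonneg_right this (Real.exp_pos _)))
    have := h hx (Set.self_mem_Iic) hx
    simp only [h0, mul_zero] at this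
    exact nonpos_of_mul_nonpos_right this (Real.exp_pos _)

/-! ### Comparison of profiles and the sliding method. -/

namespace IsWaveProfile

variable {r b c : ℝ} {φ dφ θ dθ φ₁ dφ₁ θ₁ dθ₁ φ₂ dφ₂ θ₂ dθ₂ : ℝ → ℝ}

theorem continuous_φ (h : IsWaveProfile r b c φ dφ θ dθ) : Continuous φ :=
  continuous_iff_continuousAt.2 fun x => (h.deriv_φ x).continuousAt

theorem continuous_θ (h : IsWaveProfile r b c φ dφ θ dθ) : Continuous θ :=
  continuous_iff_continuousAt.2 fun x => (h.deriv_θ x).continuousAt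

theorem φ_le_one (h : IsWaveProfile r b c φ dφ θ dθ) (x : ℝ) : φ x ≤ 1 :=
  h.mono_φ.ge_of_tendsto h.φ_top x

theorem θ_le_one (h : IsWaveProfile r b c φ dφ θ dθ) (x : ℝ) : θ x ≤ 1 :=
  ge_of_tendsto h.θ_bot ((eventually_le_atBot x).mono fun _ hy => h.anti_θ hy)

/-- The second derivative of the difference of the first components. -/
theorem hasDerivAt_dφ_sub (h₁ : IsWaveProfile r b c φ₁ dφ₁ θ₁ dθ₁)
    (h₂ : IsWaveProfile r b c φ₂ dφ₂ θ₂ dθ₂) (x : ℝ) :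
    HasDerivAt (fun x => dφ₁ x - dφ₂ x)
      (c * (dφ₁ x - dφ₂ x) - ((φ₁ x - φ₂ x) * (1 - φ₁ x - φ₂ x - r * θ₁ x)
        + r * φ₂ x * (θ₂ x - θ₁ x))) x :=
  ((h₁.deriv_dφ x).sub (h₂.deriv_dφ x)).congr_deriv (by ring)

/-- The second derivative of the difference of the second components. -/
theorem hasDerivAt_dθ_sub (h₁ : IsWaveProfile r b c φ₁ dφ₁ θ₁ dθ₁)
    (h₂ : IsWaveProfile r b c φ₂ dφ₂ θ₂ dθ₂) (x : ℝ) :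
    HasDerivAt (fun x => dθ₂ x - dθ₁ x)
      (c * (dθ₂ x - dθ₁ x) + b * (φ₁ x * (θ₂ x - θ₁ x) - θ₂ x * (φ₁ x - φ₂ x))) x :=
  ((h₂.deriv_dθ x).sub (h₁.deriv_dθ x)).congr_deriv (by ring)

theorem at_min_φ_sub (h₁ : IsWaveProfile r b c φ₁ dφ₁ θ₁ dθ₁)
    (h₂ : IsWaveProfile r b c φ₂ dφ₂ θ₂ dθ₂) {y : ℝ}
    (hy : IsLocalMin (fun z => φ₁ z - φ₂ z) y) :
    (φ₁ y - φ₂ y) * (1 - φ₁ y - φ₂ y - r * θ₁ y) + r * φ₂ y * (θ₂ y - θ₁ y) ≤ 0 := by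
  have hd : ∀ x, HasDerivAt (fun z => φ₁ z - φ₂ z) (dφ₁ x - dφ₂ x) x := fun x =>
    (h₁.deriv_φ x).sub (h₂.deriv_φ x)
  have h := second_deriv_nonneg_of_isLocalMin hd (hasDerivAt_dφ_sub h₁ h₂ y) hy
  rw [hy.hasDerivAt_eq_zero (hd y)] at h
  linarith

theorem at_min_θ_sub (hb : 0 < b) (h₁ : IsWaveProfile r b c φ₁ dφ₁ θ₁ dθ₁)
    (h₂ : IsWaveProfile r b c φ₂ dφ₂ θ₂ dθ₂) {y : ℝ}
    (hy : IsLocalMin (fun z => θ₂ z - θ₁ z) y) :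
    θ₂ y * (φ₁ y - φ₂ y) ≤ φ₁ y * (θ₂ y - θ₁ y) := by
  have hd : ∀ x, HasDerivAt (fun z => θ₂ z - θ₁ z) (dθ₂ x - dθ₁ x) x := fun x =>
    (h₂.deriv_θ x).sub (h₁.deriv_θ x)
  have h := second_deriv_nonneg_of_isLocalMin hd (hasDerivAt_dθ_sub h₁ h₂ y) hy
  rw [hy.hasDerivAt_eq_zero (hd y), mul_zero, zero_add] at h
  linarith [nonneg_of_mul_nonneg_right h hb]

/-- Comparison on a half line near `+∞`, where both profiles are close to `(1, 0)`. -/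
theorem le_on_Ici (hr : 0 < r) (hb : 0 < b) (h₁ : IsWaveProfile r b c φ₁ dφ₁ θ₁ dθ₁)
    (h₂ : IsWaveProfile r b c φ₂ dφ₂ θ₂ dθ₂) {T : ℝ} (hφ₁ : ∀ x, T ≤ x → 3 / 4 ≤ φ₁ x)
    (hφ₂ : ∀ x, T ≤ x → 3 / 4 ≤ φ₂ x) (hθ₂ : ∀ x, T ≤ x → θ₂ x * (2 * r + 1) ≤ 1 / 2)
    (hφT : φ₂ T ≤ φ₁ T) (hθT : θ₁ T ≤ θ₂ T) {x : ℝ} (hx : T ≤ x) :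
    φ₂ x ≤ φ₁ x ∧ θ₁ x ≤ θ₂ x := by
  -- The weight must exceed `2r`: near `+∞` the damping coefficient of `φ₁ - φ₂` is at least `1/2`,
  -- while its coupling to `θ₂ - θ₁` is at most `r`. At a negative minimum of the weighted `min`,
  -- the component that attains it has a local minimum too, and its equation is contradicted there.
  set K := 2 * r + 1 with hK
  have hKpos : 0 < K := by positivity
  set f : ℝ → ℝ := fun x => min ((φ₁ x - φ₂ x) / K) (θ₂ x - θ₁ x) with hf
  suffices hfx : 0 ≤ f x by
    have h1 := hfx.trans (min_le_left _ _)
    have h2 := hfx.trans (min_le_right _ _)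
    have h3 : 0 ≤ φ₁ x - φ₂ x := by
      by_contra! h
      exact absurd (div_neg_of_neg_of_pos h hKpos) (not_lt.2 h1)
    constructor <;> linarith
  by_contra! hfx
  have c1 := h₁.continuous_φ
  have c2 := h₂.continuous_φ
  have c3 := h₁.continuous_θ
  have c4 := h₂.continuous_θ
  have hlim : Tendsto f atTop (𝓝 0) := by
    have := ((h₁.φ_top.sub h₂.φ_top).div_const K).min (h₂.θ_top.sub h₁.θ_top)
    simpa using this
  obtain ⟨y, hTy, hy, hmin⟩ := exists_interior_min_Ici (f := f) (by fun_prop) hlim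
    (le_min (div_nonneg (by linarith) hKpos.le) (by linarith)) hx hfx
  set m := f y with hm
  have hnear : ∀ᶠ z in 𝓝 y, m ≤ f z := by
    filter_upwards [lt_mem_nhds hTy] with z hz using hmin z hz.le
  have hp : ∀ z, m ≤ f z → m * K ≤ φ₁ z - φ₂ z := fun z hz =>
    (le_div_iff₀ hKpos).1 (hz.trans (min_le_left _ _))
  have hq : ∀ z, m ≤ f z → m ≤ θ₂ z - θ₁ z := fun z hz => hz.trans (min_le_right _ _)
  have a1 := hφ₁ y hTy.le
  have a2 := hφ₂ y hTy.le
  have a3 := hθ₂ y hTy.le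
  have hpy := hp y le_rfl
  have hqy := hq y le_rfl
  have p1 := h₁.pos_θ y
  have p2 := h₂.pos_θ y
  have p3 := h₂.φ_le_one y
  rcases min_choice ((φ₁ y - φ₂ y) / K) (θ₂ y - θ₁ y) with hc | hc
  · have heq : φ₁ y - φ₂ y = m * K := by
      have : m = (φ₁ y - φ₂ y) / K := hc
      rw [this]; field_simp
    have hloc : IsLocalMin (fun z => φ₁ z - φ₂ z) y := by
      filter_upwards [hnear] with z hz
      rw [heq]; exact hp z hz
    have hdd := at_min_φ_sub h₁ h₂ hloc
    rw [heq] at hdd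
    have e1 : m * K * (-(1 / 2)) ≤ m * K * (1 - φ₁ y - φ₂ y - r * θ₁ y) :=
      mul_le_mul_of_nonpos_left (by nlinarith) (mul_nonpos_of_nonpos_of_nonneg hy.le hKpos.le)
    have e2 : r * φ₂ y * m ≤ r * φ₂ y * (θ₂ y - θ₁ y) :=
      mul_le_mul_of_nonneg_left hqy (by positivity)
    have e3 : r * (1 * m) ≤ r * (φ₂ y * m) :=
      mul_le_mul_of_nonneg_left (mul_le_mul_of_nonpos_right p3 hy.le) hr.le
    rw [hK] at e1
    nlinarith
  · have heq : θ₂ y - θ₁ y = m := hc.symm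
    have hloc : IsLocalMin (fun z => θ₂ z - θ₁ z) y := by
      filter_upwards [hnear] with z hz
      rw [heq]; exact hq z hz
    have hdd := at_min_θ_sub hb h₁ h₂ hloc
    rw [heq] at hdd
    have e1 : θ₂ y * (m * K) ≤ θ₂ y * (φ₁ y - φ₂ y) := mul_le_mul_of_nonneg_left hpy p2.le
    nlinarith

/-- Near `-∞` the order of the first components implies that of the second ones. -/
theorem θ_le_on_Iic (hb : 0 < b) (h₁ : IsWaveProfile r b c φ₁ dφ₁ θ₁ dθ₁)
    (h₂ : IsWaveProfile r b c φ₂ dφ₂ θ₂ dθ₂) {T : ℝ} (hφ : ∀ x, x ≤ T → φ₂ x ≤ φ₁ x)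
    (hθT : θ₁ T ≤ θ₂ T) {x : ℝ} (hx : x ≤ T) : θ₁ x ≤ θ₂ x := by
  by_contra! hlt
  have c3 := h₁.continuous_θ
  have c4 := h₂.continuous_θ
  have hlim : Tendsto (fun x => θ₂ x - θ₁ x) atBot (𝓝 0) := by
    simpa using h₂.θ_bot.sub h₁.θ_bot
  obtain ⟨y, hyT, hy, hmin⟩ := exists_interior_min_Iic (f := fun x => θ₂ x - θ₁ x)
    (by fun_prop) hlim (by simpa using hθT) hx (by simpa using hlt)
  have hloc : IsLocalMin (fun z => θ₂ z - θ₁ z) y := by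
    filter_upwards [gt_mem_nhds hyT] with z hz using hmin z hz.le
  have hdd := at_min_θ_sub hb h₁ h₂ hloc
  have e1 : 0 ≤ θ₂ y * (φ₁ y - φ₂ y) :=
    mul_nonneg (h₂.pos_θ y).le (sub_nonneg.2 (hφ y hyT.le))
  have e2 := mul_neg_of_pos_of_neg (h₁.pos_φ y) hy
  linarith

/-- Strong comparison principle: ordered profiles are equal or strictly ordered. -/
theorem eq_or_lt (hr : 0 < r) (hb : 0 < b) (h₁ : IsWaveProfile r b c φ₁ dφ₁ θ₁ dθ₁)
    (h₂ : IsWaveProfile r b c φ₂ dφ₂ θ₂ dθ₂) (hφ : ∀ x, φ₂ x ≤ φ₁ x) (hθ : ∀ x, θ₁ x ≤ θ₂ x) :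
    (∀ x, φ₂ x = φ₁ x) ∨ ∀ x, φ₂ x < φ₁ x ∧ θ₁ x < θ₂ x := by
  have hp : ∀ x, 0 ≤ φ₁ x - φ₂ x := fun x => sub_nonneg.2 (hφ x)
  have hq : ∀ x, 0 ≤ θ₂ x - θ₁ x := fun x => sub_nonneg.2 (hθ x)
  by_cases hex : ∃ x, φ₁ x - φ₂ x = 0
  · obtain ⟨x₀, hx₀⟩ := hex
    left
    intro x
    have := eq_zero_of_nonneg_supersolution (p := fun x => φ₁ x - φ₂ x) (N := 1 + r)
      (fun x => (h₁.deriv_φ x).sub (h₂.deriv_φ x)) (hasDerivAt_dφ_sub h₁ h₂) hp (fun x => by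
        have e1 : 0 ≤ r * φ₂ x * (θ₂ x - θ₁ x) :=
          mul_nonneg (mul_nonneg hr.le (h₂.pos_φ x).le) (hq x)
        have e2 : 0 ≤ (φ₁ x - φ₂ x) * (2 - φ₁ x - φ₂ x + r * (1 - θ₁ x)) := by
          refine mul_nonneg (hp x) ?_
          have := mul_nonneg hr.le (sub_nonneg.2 (h₁.θ_le_one x))
          linarith [h₁.φ_le_one x, h₂.φ_le_one x]
        linarith) hx₀ x
    linarith
  · push Not at hex
    right
    have hp' : ∀ x, 0 < φ₁ x - φ₂ x := fun x => lt_of_le_of_ne (hp x) (hex x).symm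
    intro x₀
    refine ⟨sub_pos.1 (hp' x₀), sub_pos.1 (lt_of_le_of_ne (hq x₀) fun h0 => ?_)⟩
    have hzero := eq_zero_of_nonneg_supersolution (p := fun x => θ₂ x - θ₁ x) (N := b)
      (fun x => (h₂.deriv_θ x).sub (h₁.deriv_θ x)) (hasDerivAt_dθ_sub h₁ h₂) hq (fun x => by
        have e1 : 0 ≤ θ₂ x * (φ₁ x - φ₂ x) := mul_nonneg (h₂.pos_θ x).le (hp x)
        have e2 : 0 ≤ (1 - φ₁ x) * (θ₂ x - θ₁ x) :=
          mul_nonneg (sub_nonneg.2 (h₁.φ_le_one x)) (hq x)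
        have e3 := mul_nonneg hb.le (add_nonneg e1 e2)
        linarith) h0.symm
    -- If `θ₂ - θ₁` vanishes identically, its equation leaves only the source `θ₂ (φ₁ - φ₂)`, which
    -- is positive.
    have hloc : IsLocalMin (fun z => θ₂ z - θ₁ z) x₀ :=
      Eventually.of_forall fun z => by simp only [hzero]; exact le_rfl
    have hdd := at_min_θ_sub hb h₁ h₂ hloc
    rw [hzero x₀, mul_zero] at hdd
    exact absurd (mul_pos (h₂.pos_θ x₀) (hp' x₀)) (not_lt.2 hdd)

/-- If `1 - φ` vanished somewhere, the strong maximum principle would make `φ` identically `1`,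
against its limit at `-∞`. -/
theorem φ_lt_one (hr : 0 < r) (h : IsWaveProfile r b c φ dφ θ dθ) (x : ℝ) : φ x < 1 := by
  refine lt_of_le_of_ne (h.φ_le_one x) fun hx => ?_
  have hzero := eq_zero_of_nonneg_supersolution (p := fun x => 1 - φ x) (dp := fun x => -dφ x)
    (c := c) (N := 1) (x₀ := x) (fun x => ((h.deriv_φ x).const_sub 1)) (fun x => (h.deriv_dφ x).neg)
    (fun x => sub_nonneg.2 (h.φ_le_one x)) (fun x => by
      have e1 := mul_pos (mul_pos hr (h.pos_θ x)) (h.pos_φ x)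
      have e2 := mul_nonneg (sub_nonneg.2 (h.φ_le_one x)) (sub_nonneg.2 (h.φ_le_one x))
      nlinarith) (by simp [hx])
  have h0 : φ = fun _ => 1 := funext fun y => by linarith [hzero y]
  have := h.φ_bot
  rw [h0] at this
  exact zero_ne_one (tendsto_nhds_unique this tendsto_const_nhds)

/-- Sliding method: if the translates of the first profile by more than `s₀` dominate the second
profile near `-∞`, then they dominate it everywhere. -/
theorem sliding (hr : 0 < r) (hb : 0 < b) (h₁ : IsWaveProfile r b c φ₁ dφ₁ θ₁ dθ₁)
    (h₂ : IsWaveProfile r b c φ₂ dφ₂ θ₂ dθ₂) {s₀ : ℝ}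
    (hS : ∀ s, s₀ < s → ∀ᶠ x in atBot, φ₂ x < φ₁ (x + s)) {s : ℝ} (hs : s₀ < s) (x : ℝ) :
    φ₂ x ≤ φ₁ (x + s) ∧ θ₁ (x + s) ≤ θ₂ x := by
  have c1 := h₁.continuous_φ
  have c2 := h₂.continuous_φ
  have c3 := h₁.continuous_θ
  have c4 := h₂.continuous_θ
  set A : Set ℝ := {s | ∀ x, φ₂ x ≤ φ₁ (x + s) ∧ θ₁ (x + s) ≤ θ₂ x} with hA
  suffices hsA : s ∈ A from hsA x
  by_contra hnot
  have hup : ∀ t ∈ A, ∀ t', t ≤ t' → t' ∈ A := fun t ht t' htt' x =>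
    ⟨(ht x).1.trans (h₁.mono_φ (by linarith)), (h₁.anti_θ (by linarith)).trans (ht x).2⟩
  have hlow : ∀ t ∈ A, s ≤ t := fun t ht => by
    by_contra! hlt
    exact hnot (hup t ht s hlt.le)
  have hclosed : IsClosed A := by
    simp only [hA, Set.ofPred_forall, Set.ofPred_and]
    refine isClosed_iInter fun x => IsClosed.inter ?_ ?_
    · exact isClosed_le continuous_const (by fun_prop)
    · exact isClosed_le (by fun_prop) continuous_const
  obtain ⟨T₁, hT₁⟩ := eventually_atBot.1 (hS s hs)
  have hs₁ := h₁.shift s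
  have hev := ((hs₁.φ_top.eventually_const_le (show (3 / 4 : ℝ) < 1 by norm_num)).and
    (h₂.φ_top.eventually_const_le (show (3 / 4 : ℝ) < 1 by norm_num))).and
    ((h₂.θ_top.mul_const (2 * r + 1)).eventually_le_const
      (show 0 * (2 * r + 1) < 1 / 2 by norm_num))
  obtain ⟨T₂, hT₂⟩ := eventually_atTop.1 (hev.and (eventually_ge_atTop T₁))
  have hT₁₂ : T₁ ≤ T₂ := (hT₂ T₂ le_rfl).2
  -- Order on the fixed interval `[T₁, T₂]` suffices: `T₁` and `T₂` are chosen for the shift `s`,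
  -- and by monotonicity of `φ₁` they serve every larger shift.
  have hext : ∀ t, s ≤ t → (∀ x ∈ Set.Icc T₁ T₂, φ₂ x ≤ φ₁ (x + t) ∧ θ₁ (x + t) ≤ θ₂ x) →
      t ∈ A := by
    intro t hst hmid x
    have ht₁ := h₁.shift t
    have hmono : ∀ y, φ₁ (y + s) ≤ φ₁ (y + t) := fun y => h₁.mono_φ (by linarith)
    rcases le_total x T₁ with hx | hx
    · exact ⟨(hT₁ x hx).le.trans (hmono x), θ_le_on_Iic hb ht₁ h₂
        (fun y hy => (hT₁ y hy).le.trans (hmono y)) (hmid T₁ ⟨le_rfl, hT₁₂⟩).2 hx⟩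
    rcases le_total x T₂ with hx' | hx'
    · exact hmid x ⟨hx, hx'⟩
    · exact le_on_Ici hr hb ht₁ h₂ (fun y hy => (hT₂ y hy).1.1.1.trans (hmono y))
        (fun y hy => (hT₂ y hy).1.1.2) (fun y hy => (hT₂ y hy).1.2) (hmid T₂ ⟨hT₁₂, le_rfl⟩).1
        (hmid T₂ ⟨hT₁₂, le_rfl⟩).2 hx'
  -- For a large shift, the worst values on the interval are compared: `φ₂ T₂ < 1` and `θ₂ T₂ > 0`.
  have hne : A.Nonempty := by
    have hadd : Tendsto (fun t => T₁ + t) atTop atTop := tendsto_atTop_add_const_left _ _ tendsto_id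
    obtain ⟨t, ⟨h1, h2⟩, h3⟩ := ((((h₁.φ_top.comp hadd).eventually_const_le
      (h₂.φ_lt_one hr T₂)).and ((h₁.θ_top.comp hadd).eventually_le_const (h₂.pos_θ T₂))).and
      (eventually_ge_atTop s)).exists
    refine ⟨t, hext t h3 fun x hx => ⟨?_, ?_⟩⟩
    · exact (h₂.mono_φ hx.2).trans (h1.trans (h₁.mono_φ (by linarith [hx.1])))
    · exact (h₁.anti_θ (by linarith [hx.1])).trans (h2.trans (h₂.anti_θ hx.2))
  have hbdd : BddBelow A := ⟨s, hlow⟩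
  have hmem : sInf A ∈ A := hclosed.csInf_mem hne hbdd
  set t := sInf A with ht
  have hst : s < t := lt_of_le_of_ne (hlow t hmem) fun h => hnot (h ▸ hmem)
  -- At the critical shift `t > s`, equality contradicts the strict order at `T₁`. Strict order
  -- persists on the compact interval for slightly smaller shifts, against minimality.
  rcases eq_or_lt hr hb (h₁.shift t) h₂ (fun x => (hmem x).1) (fun x => (hmem x).2) with heq | hlt
  · have h1 := hT₁ T₁ le_rfl
    have h2 := heq T₁
    have h3 : φ₁ (T₁ + s) ≤ φ₁ (T₁ + t) := h₁.mono_φ (by linarith)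
    linarith
  · have hnear : ∀ᶠ t' in 𝓝 t, ∀ x ∈ Set.Icc T₁ T₂,
        φ₂ x < φ₁ (x + t') ∧ θ₁ (x + t') < θ₂ x := by
      refine isCompact_Icc.eventually_forall_of_forall_eventually fun x _ => ?_
      refine Eventually.and ?_ ?_
      · exact ContinuousAt.eventually_lt (f := fun z : ℝ × ℝ => φ₂ z.2)
          (g := fun z : ℝ × ℝ => φ₁ (z.2 + z.1)) (by fun_prop) (by fun_prop) (hlt x).1
      · exact ContinuousAt.eventually_lt (f := fun z : ℝ × ℝ => θ₁ (z.2 + z.1))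
          (g := fun z : ℝ × ℝ => θ₂ z.2) (by fun_prop) (by fun_prop) (hlt x).2
    have hleft : ∀ᶠ t' in 𝓝[<] t, t' ∈ A := by
      filter_upwards [nhdsWithin_le_nhds hnear, nhdsWithin_le_nhds (lt_mem_nhds hst)] with t' h1 h2
      exact hext t' h2.le fun x hx => ⟨(h1 x hx).1.le, (h1 x hx).2.le⟩
    obtain ⟨t', h1, h2⟩ := (hleft.and self_mem_nhdsWithin).exists
    exact absurd (csInf_le hbdd h1) (not_le.2 h2)

end IsWaveProfile

/-! ### Scalar asymptotics at `-∞`. -/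

theorem hasDerivAt_exp_mul (m t : ℝ) :
    HasDerivAt (fun t => Real.exp (m * t)) (m * Real.exp (m * t)) t := by
  simpa [mul_comm] using ((hasDerivAt_id t).const_mul m).exp

theorem tendsto_exp_mul_atBot {m : ℝ} (hm : 0 < m) :
    Tendsto (fun t => Real.exp (m * t)) atBot (𝓝 0) :=
  Real.tendsto_exp_atBot.comp (tendsto_id.const_mul_atBot hm)

theorem exists_deriv_eq_increment {f df : ℝ → ℝ} (hf : ∀ x, HasDerivAt f (df x) x) (t : ℝ) :
    ∃ u, t < u ∧ u < t + 1 ∧ df u = f (t + 1) - f t := by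
  obtain ⟨u, hu, h⟩ := exists_hasDerivAt_eq_slope f df (by linarith : t < t + 1)
    (fun x _ => (hf x).continuousAt.continuousWithinAt) (fun x _ => hf x)
  exact ⟨u, hu.1, hu.2, by simpa using h⟩

/-- If `f` converges at `-∞` then `f'` tends to zero along some path to `-∞`. -/
theorem exists_tendsto_deriv_zero_atBot {f df : ℝ → ℝ} {l : ℝ} (hf : ∀ x, HasDerivAt f (df x) x)
    (hl : Tendsto f atBot (𝓝 l)) :
    ∃ u : ℝ → ℝ, Tendsto u atBot atBot ∧ Tendsto (fun t => df (u t)) atBot (𝓝 0) := by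
  choose u h1 h2 h3 using exists_deriv_eq_increment hf
  have hadd : Tendsto (fun t : ℝ => t + 1) atBot atBot :=
    tendsto_atBot_add_const_right _ _ tendsto_id
  refine ⟨u, tendsto_atBot_mono (fun t => (h2 t).le) hadd, ?_⟩
  simp only [h3]
  simpa using (hl.comp hadd).sub hl

theorem exists_tendsto_deriv_zero_atTop {f df : ℝ → ℝ} {l : ℝ} (hf : ∀ x, HasDerivAt f (df x) x)
    (hl : Tendsto f atTop (𝓝 l)) :
    ∃ u : ℝ → ℝ, Tendsto u atTop atTop ∧ Tendsto (fun t => df (u t)) atTop (𝓝 0) := by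
  choose u h1 h2 h3 using exists_deriv_eq_increment hf
  have hadd : Tendsto (fun t : ℝ => t + 1) atTop atTop :=
    tendsto_atTop_add_const_right _ _ tendsto_id
  refine ⟨u, tendsto_atTop_mono (fun t => (h1 t).le) tendsto_id, ?_⟩
  simp only [h3]
  simpa using (hl.comp hadd).sub hl

theorem monotoneOn_Iic_of_deriv {f df : ℝ → ℝ} {T : ℝ} (hf : ∀ x, HasDerivAt f (df x) x)
    (h : ∀ x, x ≤ T → 0 ≤ df x) : MonotoneOn f (Set.Iic T) :=
  monotoneOn_of_hasDerivWithinAt_nonneg (convex_Iic T)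
    (fun x _ => (hf x).continuousAt.continuousWithinAt) (fun x _ => (hf x).hasDerivWithinAt)
    fun x hx => h x (by rw [interior_Iic] at hx; exact le_of_lt hx)

theorem antitoneOn_Iic_of_deriv {f df : ℝ → ℝ} {T : ℝ} (hf : ∀ x, HasDerivAt f (df x) x)
    (h : ∀ x, x ≤ T → df x ≤ 0) : AntitoneOn f (Set.Iic T) :=
  antitoneOn_of_hasDerivWithinAt_nonpos (convex_Iic T)
    (fun x _ => (hf x).continuousAt.continuousWithinAt) (fun x _ => (hf x).hasDerivWithinAt)
    fun x hx => h x (by rw [interior_Iic] at hx; exact le_of_lt hx)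

/-- A bounded solution of an asymptotically autonomous Riccati equation converges at `-∞`, and its
limit is an equilibrium of the limiting equation. -/
theorem tendsto_of_riccati {z k : ℝ → ℝ} {c l M : ℝ}
    (hz : ∀ t, HasDerivAt z (c * z t - z t ^ 2 - k t) t) (hk : Tendsto k atBot (𝓝 l))
    (h0 : ∀ t, 0 ≤ z t) (hM : ∀ t, z t ≤ M) :
    ∃ L, Tendsto z atBot (𝓝 L) ∧ c * L - L ^ 2 - l = 0 := by
  -- Away from the at most two equilibria, the sign of `z'` on the level `a` is constant near `-∞`,
  -- so the level can be crossed in only one direction. Oscillation is thereby excluded.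
  have hdense : Dense {a : ℝ | c * a - a ^ 2 - l ≠ 0} := by
    have hfin : {a : ℝ | c * a - a ^ 2 - l = 0}.Finite := by
      rcases Set.eq_empty_or_nonempty {a : ℝ | c * a - a ^ 2 - l = 0} with h | ⟨a₀, ha₀⟩
      · rw [h]; exact Set.finite_empty
      · refine (Set.toFinite {a₀, c - a₀}).subset fun a ha => ?_
        have h1 : c * a - a ^ 2 - l = 0 := ha
        have h2 : c * a₀ - a₀ ^ 2 - l = 0 := ha₀
        have h3 : (a - a₀) * (a - (c - a₀)) = 0 := by linarith
        rcases mul_eq_zero.1 h3 with h | h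
        · left; linarith
        · right; exact sub_eq_zero.1 h
    exact hfin.countable.dense_compl ℝ
  have hcont : Continuous z := continuous_iff_continuousAt.2 fun t => (hz t).continuousAt
  obtain ⟨L, hL⟩ : ∃ L, Tendsto z atBot (𝓝 L) := by
    refine tendsto_of_no_upcrossings hdense ?_
      (isBoundedUnder_of ⟨M, hM⟩) (isBoundedUnder_of ⟨0, h0⟩)
    rintro a ha b' - hab ⟨hlo, hhi⟩
    have hlim : Tendsto (fun t => c * a - a ^ 2 - k t) atBot (𝓝 (c * a - a ^ 2 - l)) :=
      hk.const_sub _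
    rcases lt_or_gt_of_ne (show c * a - a ^ 2 - l ≠ 0 from ha) with hneg | hpos
    · obtain ⟨T, hT⟩ := eventually_atBot.1 (hlim.eventually_lt_const hneg)
      obtain ⟨t₁, h1, h1T⟩ := (hhi.and_eventually (eventually_le_atBot T)).exists
      obtain ⟨t₂, h2, h2t⟩ := (hlo.and_eventually (eventually_le_atBot t₁)).exists
      have := image_le_of_deriv_right_lt_deriv_boundary (f := z) (a := t₂) (b := t₁)
        (B := fun _ => a) (B' := fun _ => 0) hcont.continuousOn
        (fun x _ => (hz x).hasDerivWithinAt) h2.le (fun x => hasDerivAt_const x a)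
        (fun x hx hxa => by
          rw [hxa]; exact hT x (hx.2.le.trans h1T)) ⟨h2t, le_rfl⟩
      linarith
    · obtain ⟨T, hT⟩ := eventually_atBot.1 (hlim.eventually_const_lt hpos)
      obtain ⟨t₁, h1, h1T⟩ := (hlo.and_eventually (eventually_le_atBot T)).exists
      obtain ⟨t₂, h2, h2t⟩ := (hhi.and_eventually (eventually_le_atBot t₁)).exists
      have := image_le_of_deriv_right_lt_deriv_boundary (f := fun t => -z t) (a := t₂) (b := t₁)
        (B := fun _ => -a) (B' := fun _ => 0) hcont.neg.continuousOn
        (fun x _ => (hz x).neg.hasDerivWithinAt) (by linarith) (fun x => hasDerivAt_const x (-a))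
        (fun x hx hxa => by
          rw [neg_inj.1 hxa]; linarith [hT x (hx.2.le.trans h1T)]) ⟨h2t, le_rfl⟩
      linarith
  refine ⟨L, hL, ?_⟩
  obtain ⟨u, hu, hdu⟩ := exists_tendsto_deriv_zero_atBot hz hL
  have hLu := hL.comp hu
  have hku := hk.comp hu
  exact tendsto_nhds_unique (((hLu.const_mul c).sub (hLu.pow 2)).sub hku) hdu

theorem hasDerivAt_mul_exp {f df : ℝ → ℝ} (hf : ∀ x, HasDerivAt f (df x) x) (γ t : ℝ) :
    HasDerivAt (fun t => Real.exp (-γ * t) * f t) (Real.exp (-γ * t) * (df t - γ * f t)) t :=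
  ((hasDerivAt_exp_mul (-γ) t).mul (hf t)).congr_deriv (by ring)

/-- Near `-∞` the function `e^{-γt} f` is nondecreasing, hence bounded there by its value at some
`T`. -/
theorem exp_bound_of_log_deriv {f df : ℝ → ℝ} {L γ : ℝ} (hf : ∀ x, HasDerivAt f (df x) x)
    (hpos : ∀ x, 0 < f x) (hL : Tendsto (fun t => df t / f t) atBot (𝓝 L)) (hγ : γ < L) :
    ∃ C, 0 < C ∧ ∀ᶠ t in atBot, f t ≤ C * Real.exp (γ * t) := by
  obtain ⟨T, hT⟩ := eventually_atBot.1 (hL.eventually_const_lt hγ)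
  have hm := monotoneOn_Iic_of_deriv (T := T) (hasDerivAt_mul_exp hf γ) fun x hx =>
    mul_nonneg (Real.exp_pos _).le (by
      have := (lt_div_iff₀ (hpos x)).1 (hT x hx)
      linarith)
  refine ⟨Real.exp (-γ * T) * f T, mul_pos (Real.exp_pos _) (hpos T),
    eventually_atBot.2 ⟨T, fun t ht => ?_⟩⟩
  have := mul_le_mul_of_nonneg_right (hm ht Set.self_mem_Iic ht) (Real.exp_pos (γ * t)).le
  calc f t = Real.exp (-γ * t) * f t * Real.exp (γ * t) := by
        rw [mul_right_comm, ← Real.exp_add]; simp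
    _ ≤ _ := this

theorem exp_lower_bound_of_log_deriv {f df : ℝ → ℝ} {L γ : ℝ} (hf : ∀ x, HasDerivAt f (df x) x)
    (hpos : ∀ x, 0 < f x) (hL : Tendsto (fun t => df t / f t) atBot (𝓝 L)) (hγ : L < γ) :
    ∃ C, 0 < C ∧ ∀ᶠ t in atBot, C * Real.exp (γ * t) ≤ f t := by
  obtain ⟨T, hT⟩ := eventually_atBot.1 (hL.eventually_lt_const hγ)
  have hm := antitoneOn_Iic_of_deriv (T := T) (hasDerivAt_mul_exp hf γ) fun x hx =>
    mul_nonpos_of_nonneg_of_nonpos (Real.exp_pos _).le (by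
      have := (div_lt_iff₀ (hpos x)).1 (hT x hx)
      linarith)
  refine ⟨Real.exp (-γ * T) * f T, mul_pos (Real.exp_pos _) (hpos T),
    eventually_atBot.2 ⟨T, fun t ht => ?_⟩⟩
  have := mul_le_mul_of_nonneg_right (hm ht Set.self_mem_Iic ht) (Real.exp_pos (γ * t)).le
  calc _ ≤ Real.exp (-γ * t) * f t * Real.exp (γ * t) := this
    _ = f t := by rw [mul_right_comm, ← Real.exp_add]; simp

/-- Integrating an exponential bound on the derivative, with either sign of the exponent. -/
theorem exists_const_of_exp_deriv_bound {w dw : ℝ → ℝ} {C m T : ℝ} (hm : m ≠ 0)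
    (hw : ∀ t, HasDerivAt w (dw t) t) (hb : ∀ t, t ≤ T → |dw t| ≤ C * Real.exp (m * t)) :
    ∃ K, ∀ t, t ≤ T → |w t - K| ≤ |C / m| * Real.exp (m * t) := by
  have hd : ∀ t, HasDerivAt (fun t => C / m * Real.exp (m * t)) (C * Real.exp (m * t)) t :=
    fun t => ((hasDerivAt_exp_mul m t).const_mul (C / m)).congr_deriv (by field_simp)
  have hmono : MonotoneOn (fun t => w t + C / m * Real.exp (m * t)) (Set.Iic T) :=
    monotoneOn_Iic_of_deriv (fun t => (hw t).add (hd t)) fun t ht => by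
      linarith [(abs_le.1 (hb t ht)).1]
  have hanti : AntitoneOn (fun t => w t - C / m * Real.exp (m * t)) (Set.Iic T) :=
    antitoneOn_Iic_of_deriv (fun t => (hw t).sub (hd t)) fun t ht => by
      linarith [(abs_le.1 (hb t ht)).2]
  have hC : 0 ≤ C := by
    have := (abs_nonneg _).trans (hb T le_rfl)
    exact nonneg_of_mul_nonneg_left this (Real.exp_pos _)
  rcases lt_or_gt_of_ne hm with hneg | hpos
  -- For `m < 0` the permitted error grows towards `-∞`, so the constant need not be a limit and the
  -- value at `T` serves.
  · refine ⟨w T, fun t ht => ?_⟩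
    have hCm : C / m ≤ 0 := div_nonpos_of_nonneg_of_nonpos hC hneg.le
    have h1 := hmono ht Set.self_mem_Iic ht
    have h2 := hanti ht Set.self_mem_Iic ht
    have h3 := mul_nonpos_of_nonpos_of_nonneg hCm (Real.exp_pos (m * T)).le
    simp only at h1 h2
    rw [abs_of_nonpos hCm, abs_le]
    constructor <;> linarith
  · have hCm : 0 ≤ C / m := div_nonneg hC hpos.le
    have hle : ∀ s ∈ Set.Iic T, ∀ t ∈ Set.Iic T,
        w s - C / m * Real.exp (m * s) ≤ w t + C / m * Real.exp (m * t) := by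
      intro s hs t ht
      have e1 := mul_nonneg hCm (Real.exp_pos (m * s)).le
      have e2 := mul_nonneg hCm (Real.exp_pos (m * t)).le
      rcases le_total s t with h | h
      · have := hmono hs ht h
        simp only at this
        linarith
      · have := hanti ht hs h
        simp only at this
        linarith
    -- For `m > 0` the lower envelopes all lie below the upper ones, and the supremum of the former
    -- separates them.
    set S := (fun t => w t - C / m * Real.exp (m * t)) '' Set.Iic T
    have hbdd : BddAbove S := by
      refine ⟨w T + C / m * Real.exp (m * T), ?_⟩
      rintro _ ⟨s, hs, rfl⟩
      exact hle s hs T Set.self_mem_Iic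
    refine ⟨sSup S, fun t ht => ?_⟩
    have h1 : w t - C / m * Real.exp (m * t) ≤ sSup S := le_csSup hbdd ⟨t, ht, rfl⟩
    have h2 : sSup S ≤ w t + C / m * Real.exp (m * t) := by
      refine csSup_le ⟨_, t, ht, rfl⟩ ?_
      rintro _ ⟨s, hs, rfl⟩
      exact hle s hs t ht
    rw [abs_of_nonneg hCm, abs_le]
    constructor <;> linarith

/-- A nonnegative function whose derivative is bounded below by an integrable exponential converges
at `-∞`. -/
theorem exists_tendsto_of_exp_deriv_lower_bound {u du : ℝ → ℝ} {C κ T : ℝ} (hκ : 0 < κ)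
    (hu : ∀ t, HasDerivAt u (du t) t) (h0 : ∀ t, 0 ≤ u t)
    (hb : ∀ t, t ≤ T → -(C * Real.exp (κ * t)) ≤ du t) (hC : 0 ≤ C) :
    ∃ Λ, 0 ≤ Λ ∧ Tendsto u atBot (𝓝 Λ) := by
  have hd : ∀ t, HasDerivAt (fun t => C / κ * Real.exp (κ * t)) (C * Real.exp (κ * t)) t :=
    fun t => ((hasDerivAt_exp_mul κ t).const_mul (C / κ)).congr_deriv (by field_simp)
  have hmono : MonotoneOn (fun t => u t + C / κ * Real.exp (κ * t)) (Set.Iic T) :=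
    monotoneOn_Iic_of_deriv (fun t => (hu t).add (hd t)) fun t ht => by
      linarith [hb t ht]
  -- Freezing the argument beyond `T` turns monotonicity on a half line into global monotonicity, so
  -- that the infimum is the limit.
  set g : ℝ → ℝ := fun t => u (min t T) + C / κ * Real.exp (κ * min t T) with hg
  have hgmono : Monotone g := fun s t hst =>
    hmono (Set.mem_Iic.2 (min_le_right _ _)) (Set.mem_Iic.2 (min_le_right _ _))
      (min_le_min_right T hst)
  have hbdd : BddBelow (Set.range g) := by
    refine ⟨0, ?_⟩
    rintro _ ⟨t, rfl⟩
    exact add_nonneg (h0 _) (by positivity)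
  have hlim := tendsto_atBot_ciInf hgmono hbdd
  have hlim2 : Tendsto u atBot (𝓝 (⨅ t, g t)) := by
    have h1 := hlim.sub ((tendsto_exp_mul_atBot hκ).const_mul (C / κ))
    rw [mul_zero, sub_zero] at h1
    refine h1.congr' ?_
    filter_upwards [eventually_le_atBot T] with t ht
    simp [hg, min_eq_left ht]
  exact ⟨_, ge_of_tendsto' hlim2 h0, hlim2⟩

/-- The derivative of `log f - L t` tends to `0`, so the increment of this function over a fixed
length `s` does too. -/
theorem tendsto_shift_ratio {f df : ℝ → ℝ} {L : ℝ} (hf : ∀ x, HasDerivAt f (df x) x)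
    (hpos : ∀ x, 0 < f x) (hL : Tendsto (fun t => df t / f t) atBot (𝓝 L)) (s : ℝ) :
    Tendsto (fun t => f (t + s) / f t) atBot (𝓝 (Real.exp (L * s))) := by
  set F : ℝ → ℝ := fun t => Real.log (f t) - L * t with hF
  have hdF : ∀ t, HasDerivAt F (df t / f t - L) t := fun t =>
    (((hf t).log (hpos t).ne').sub ((hasDerivAt_id t).const_mul L)).congr_deriv (by simp)
  have hlim : Tendsto (fun t => F (t + s) - F t) atBot (𝓝 0) := by
    rw [Metric.tendsto_nhds]
    intro ε hε
    have hη : 0 < ε / (|s| + 1) := by positivity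
    obtain ⟨T, hT⟩ := eventually_atBot.1 ((Metric.tendsto_nhds.1 hL) _ hη)
    filter_upwards [eventually_le_atBot T, eventually_le_atBot (T - s)] with t h1 h2
    have := (convex_Iic T).norm_image_sub_le_of_norm_hasDerivWithin_le
      (fun x _ => (hdF x).hasDerivWithinAt) (fun x hx => (hT x hx).le)
      (Set.mem_Iic.2 h1) (Set.mem_Iic.2 (by linarith : t + s ≤ T))
    rw [dist_zero_right]
    refine this.trans_lt ?_
    rw [add_sub_cancel_left, Real.norm_eq_abs, div_mul_eq_mul_div, div_lt_iff₀ (by positivity)]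
    nlinarith [abs_nonneg s]
  have hlim2 := (Real.continuous_exp.tendsto _).comp (hlim.add_const (L * s))
  rw [zero_add] at hlim2
  refine hlim2.congr fun t => ?_
  have e : F (t + s) - F t + L * s = Real.log (f (t + s)) - Real.log (f t) := by
    simp only [hF]; ring
  rw [Function.comp_apply, e, Real.exp_sub, Real.exp_log (hpos _), Real.exp_log (hpos _)]

/-! ### Decay of profiles at `-∞` and uniqueness up to translation. -/

namespace IsWaveProfile

variable {r b c : ℝ} {φ dφ θ dθ φ₁ dφ₁ θ₁ dθ₁ φ₂ dφ₂ θ₂ dθ₂ : ℝ → ℝ}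

theorem dφ_nonneg (h : IsWaveProfile r b c φ dφ θ dθ) (x : ℝ) : 0 ≤ dφ x := by
  rw [← (h.deriv_φ x).deriv]
  exact h.mono_φ.deriv_nonneg

/-- The quantity `θ' - cθ` increases strictly, from `-c` to `0` along suitable sequences of points
where `θ'` tends to `0`. -/
theorem speed_pos (hb : 0 < b) (h : IsWaveProfile r b c φ dφ θ dθ) : 0 < c := by
  have hE : ∀ t, HasDerivAt (fun t => dθ t - c * θ t) (b * φ t * θ t) t := fun t =>
    ((h.deriv_dθ t).sub ((h.deriv_θ t).const_mul c)).congr_deriv (by ring)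
  have hmono : StrictMono fun t => dθ t - c * θ t := strictMono_of_hasDerivAt_pos hE fun t =>
    mul_pos (mul_pos hb (h.pos_φ t)) (h.pos_θ t)
  obtain ⟨u, hu, hdu⟩ := exists_tendsto_deriv_zero_atBot h.deriv_θ h.θ_bot
  obtain ⟨v, hv, hdv⟩ := exists_tendsto_deriv_zero_atTop h.deriv_θ h.θ_top
  have h1 := hdu.sub ((h.θ_bot.comp hu).const_mul c)
  have h2 := hdv.sub ((h.θ_top.comp hv).const_mul c)
  have h3 : 0 - c * 1 ≤ dθ 0 - c * θ 0 := by
    refine le_of_tendsto h1 ?_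
    filter_upwards [hu.eventually_le_atBot 0] with t ht using hmono.monotone ht
  have h4 : dθ 1 - c * θ 1 ≤ 0 - c * 0 := by
    refine ge_of_tendsto h2 ?_
    filter_upwards [hv.eventually_ge_atTop 1] with t ht using hmono.monotone ht
  have h5 : dθ 0 - c * θ 0 < dθ 1 - c * θ 1 := hmono zero_lt_one
  linarith

/-- The logarithmic derivative of the first component is bounded. -/
theorem dφ_le (hr : 0 < r) (hb : 0 < b) (h : IsWaveProfile r b c φ dφ θ dθ) (t : ℝ) :
    dφ t ≤ (c + r + 1) * φ t := by
  have hc := h.speed_pos hb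
  -- The weighted expression is nonincreasing because `1 - φ - rθ ≥ -r`, and it tends to `0` along a
  -- path to `-∞`; so it is nonpositive.
  have hd : ∀ t, HasDerivAt (fun t => Real.exp ((r + 1) * t) * (dφ t - (c + r + 1) * φ t))
      (Real.exp ((r + 1) * t) * (-(((c + r + 1) * (r + 1) + (1 - φ t - r * θ t)) * φ t))) t :=
    fun t => ((hasDerivAt_exp_mul (r + 1) t).mul
      ((h.deriv_dφ t).sub ((h.deriv_φ t).const_mul (c + r + 1)))).congr_deriv (by
        simp only [Pi.sub_apply]; ring)
  have hanti := antitone_of_hasDerivAt_nonpos hd fun t => by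
    refine mul_nonpos_of_nonneg_of_nonpos (Real.exp_pos _).le (neg_nonpos.2 ?_)
    refine mul_nonneg ?_ (h.pos_φ t).le
    have h1 := mul_le_mul_of_nonneg_left (h.θ_le_one t) hr.le
    have h2 := h.φ_le_one t
    have h3 := mul_pos hc hr
    nlinarith
  obtain ⟨u, hu, hdu⟩ := exists_tendsto_deriv_zero_atBot h.deriv_φ h.φ_bot
  have hlim := ((tendsto_exp_mul_atBot (by linarith : 0 < r + 1)).comp hu).mul
    (hdu.sub ((h.φ_bot.comp hu).const_mul (c + r + 1)))
  have hle : Real.exp ((r + 1) * t) * (dφ t - (c + r + 1) * φ t)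
      ≤ 0 * (0 - (c + r + 1) * 0) := by
    refine ge_of_tendsto hlim ?_
    filter_upwards [hu.eventually_le_atBot t] with s hs using hanti hs
  rw [zero_mul] at hle
  linarith [nonpos_of_mul_nonpos_right hle (Real.exp_pos _)]

/-- The logarithmic derivative of the first component has a positive limit at `-∞`. -/
theorem exists_decay_rate (hr : 0 < r) (hr1 : r ≠ 1) (hb : 0 < b)
    (h : IsWaveProfile r b c φ dφ θ dθ) :
    ∃ L, 0 < L ∧ Tendsto (fun t => dφ t / φ t) atBot (𝓝 L) := by
  have hz : ∀ t, HasDerivAt (fun t => dφ t / φ t)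
      (c * (dφ t / φ t) - (dφ t / φ t) ^ 2 - (1 - φ t - r * θ t)) t := fun t => by
    have := (h.pos_φ t).ne'
    exact ((h.deriv_dφ t).div (h.deriv_φ t) this).congr_deriv (by field_simp; ring)
  have h0 : ∀ t, 0 ≤ dφ t / φ t := fun t => div_nonneg (h.dφ_nonneg t) (h.pos_φ t).le
  obtain ⟨L, hL, heq⟩ := tendsto_of_riccati hz
    (((h.φ_bot.const_sub 1).sub (h.θ_bot.const_mul r))) h0
    fun t => (div_le_iff₀ (h.pos_φ t)).2 (h.dφ_le hr hb t)
  refine ⟨L, lt_of_le_of_ne (ge_of_tendsto' hL h0) ?_, hL⟩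
  rintro rfl
  apply hr1
  linarith

/-- Integrating the `θ` equation from `-∞` gives `η' - cη ≥ -(bA/γ) e^{γt}` for `η = 1 - θ`. Since
`γ < c`, a large multiple of `e^{γt}` is then a barrier for `η` on a left half line. -/
theorem one_sub_θ_exp_bound (hb : 0 < b) (h : IsWaveProfile r b c φ dφ θ dθ) {A γ : ℝ}
    (hγ : 0 < γ) (hγc : γ < c) (hA : ∀ᶠ t in atBot, φ t ≤ A * Real.exp (γ * t)) :
    ∃ C, 0 < C ∧ ∀ᶠ t in atBot, 1 - θ t ≤ C * Real.exp (γ * t) := by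
  obtain ⟨T, hT⟩ := eventually_atBot.1 hA
  have hApos : 0 < A :=
    pos_of_mul_pos_left ((h.pos_φ T).trans_le (hT T le_rfl)) (Real.exp_pos _).le
  have hE : ∀ t, HasDerivAt (fun t => dθ t - c * θ t - b * A / γ * Real.exp (γ * t))
      (b * φ t * θ t - b * A * Real.exp (γ * t)) t := fun t =>
    (((h.deriv_dθ t).sub ((h.deriv_θ t).const_mul c)).sub
      ((hasDerivAt_exp_mul γ t).const_mul (b * A / γ))).congr_deriv (by field_simp; ring)
  have hanti := antitoneOn_Iic_of_deriv (T := T) hE fun t ht => by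
    have h1 : φ t * θ t ≤ φ t * 1 := mul_le_mul_of_nonneg_left (h.θ_le_one t) (h.pos_φ t).le
    have h2 : b * (φ t * θ t) ≤ b * (A * Real.exp (γ * t)) :=
      mul_le_mul_of_nonneg_left (by linarith [hT t ht]) hb.le
    linarith
  obtain ⟨u, hu, hdu⟩ := exists_tendsto_deriv_zero_atBot h.deriv_θ h.θ_bot
  have hlim := (hdu.sub ((h.θ_bot.comp hu).const_mul c)).sub
    (((tendsto_exp_mul_atBot hγ).comp hu).const_mul (b * A / γ))
  have hEle : ∀ t, t ≤ T → dθ t - c * θ t - b * A / γ * Real.exp (γ * t)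
      ≤ 0 - c * 1 - b * A / γ * 0 := by
    intro t ht
    refine ge_of_tendsto hlim ?_
    filter_upwards [hu.eventually_le_atBot t] with s hs using hanti (hs.trans ht) ht hs
  set K := max (b * A / γ / (c - γ)) (Real.exp (-γ * T)) with hK
  have hK1 : b * A / γ ≤ K * (c - γ) := (div_le_iff₀ (by linarith)).1 (le_max_left _ _)
  -- The first entry of the maximum `K` makes `e^{-ct} (η - K e^{γt})` nondecreasing; the second
  -- makes it nonpositive at `T`.
  have hg : ∀ t, HasDerivAt (fun t => 1 - θ t - K * Real.exp (γ * t))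
      (-dθ t - K * (γ * Real.exp (γ * t))) t := fun t =>
    ((h.deriv_θ t).const_sub 1).sub ((hasDerivAt_exp_mul γ t).const_mul K)
  have hmono := monotoneOn_Iic_of_deriv (T := T) (hasDerivAt_mul_exp hg c) fun t ht => by
    refine mul_nonneg (Real.exp_pos _).le ?_
    have h1 := mul_le_mul_of_nonneg_right hK1 (Real.exp_pos (γ * t)).le
    have h2 := hEle t ht
    linarith
  refine ⟨K, lt_max_of_lt_right (Real.exp_pos _), eventually_atBot.2 ⟨T, fun t ht => ?_⟩⟩
  have h1 := hmono ht Set.self_mem_Iic ht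
  have h2 : 1 - θ T - K * Real.exp (γ * T) ≤ 0 := by
    have e1 : Real.exp (-γ * T) * Real.exp (γ * T) ≤ K * Real.exp (γ * T) :=
      mul_le_mul_of_nonneg_right (le_max_right _ _) (Real.exp_pos _).le
    rw [← Real.exp_add] at e1
    simp only [neg_mul, neg_add_cancel, Real.exp_zero] at e1
    linarith [h.pos_θ T]
  have h3 := h1.trans (mul_nonpos_of_nonneg_of_nonpos (Real.exp_pos _).le h2)
  linarith [nonpos_of_mul_nonpos_right h3 (Real.exp_pos _)]

/-- Both `φ` and `1 - θ` decay exponentially at `-∞`. -/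
theorem exists_exp_bound (hb : 0 < b) (h : IsWaveProfile r b c φ dφ θ dθ) {L δ : ℝ}
    (hL : Tendsto (fun t => dφ t / φ t) atBot (𝓝 L)) (hδ : 0 < δ) (hδL : δ < L) (hδc : δ < c) :
    ∃ G, 0 < G ∧ ∀ᶠ t in atBot, φ t ≤ G * Real.exp (δ * t) ∧ 1 - θ t ≤ G * Real.exp (δ * t) := by
  obtain ⟨A, hA, hφ⟩ := exp_bound_of_log_deriv h.deriv_φ h.pos_φ hL hδL
  obtain ⟨C, hC, hθ⟩ := h.one_sub_θ_exp_bound hb hδ hδc hφ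
  refine ⟨max A C, lt_max_of_lt_left hA, ?_⟩
  filter_upwards [hφ, hθ] with t h1 h2
  exact ⟨h1.trans (mul_le_mul_of_nonneg_right (le_max_left _ _) (Real.exp_pos _).le),
    h2.trans (mul_le_mul_of_nonneg_right (le_max_right _ _) (Real.exp_pos _).le)⟩

/-- The weighted Wronskian of the first components satisfies a first order equation. -/
theorem hasDerivAt_wronskian (h₁ : IsWaveProfile r b c φ₁ dφ₁ θ₁ dθ₁)
    (h₂ : IsWaveProfile r b c φ₂ dφ₂ θ₂ dθ₂) (t : ℝ) :
    HasDerivAt (fun t => Real.exp (-c * t) * (dφ₁ t * φ₂ t - φ₁ t * dφ₂ t))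
      (Real.exp (-c * t) * (φ₁ t * φ₂ t * (φ₁ t - φ₂ t - r * ((1 - θ₁ t) - (1 - θ₂ t))))) t :=
  ((hasDerivAt_exp_mul (-c) t).mul (((h₁.deriv_dφ t).mul (h₂.deriv_φ t)).sub
    ((h₁.deriv_φ t).mul (h₂.deriv_dφ t)))).congr_deriv (by
      simp only [Pi.sub_apply, Pi.mul_apply]; ring)

/-- The derivative of `φ₁/φ₂` is `e^{ct}/φ₂²` times the weighted Wronskian. As `K ≥ 0`, only the
error term can make it negative, and the lower bound on `φ₂` turns that into an exponential with
exponent `m + c - 2γ > 0`. -/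
theorem ratio_tendsto_of_wronskian (h₁ : IsWaveProfile r b c φ₁ dφ₁ θ₁ dθ₁)
    (h₂ : IsWaveProfile r b c φ₂ dφ₂ θ₂ dθ₂) {K C m γ D : ℝ} (hK : 0 ≤ K) (hC : 0 ≤ C) (hD : 0 < D)
    (hw : ∀ᶠ t in atBot, |Real.exp (-c * t) * (dφ₁ t * φ₂ t - φ₁ t * dφ₂ t) - K|
      ≤ C * Real.exp (m * t))
    (hlow : ∀ᶠ t in atBot, D * Real.exp (γ * t) ≤ φ₂ t) (hγ : 0 < m + c - 2 * γ) :
    ∃ Λ, 0 ≤ Λ ∧ Tendsto (fun t => φ₁ t / φ₂ t) atBot (𝓝 Λ) := by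
  obtain ⟨T, hT⟩ := eventually_atBot.1 (hw.and hlow)
  have hu : ∀ t, HasDerivAt (fun t => φ₁ t / φ₂ t)
      ((dφ₁ t * φ₂ t - φ₁ t * dφ₂ t) / φ₂ t ^ 2) t := fun t =>
    (h₁.deriv_φ t).div (h₂.deriv_φ t) (h₂.pos_φ t).ne'
  refine exists_tendsto_of_exp_deriv_lower_bound (C := C / D ^ 2) (T := T) hγ hu
    (fun t => (div_pos (h₁.pos_φ t) (h₂.pos_φ t)).le) (fun t ht => ?_) (by positivity)
  obtain ⟨h1, h2⟩ := hT t ht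
  set W := dφ₁ t * φ₂ t - φ₁ t * dφ₂ t with hW
  have hWlow : -(C * Real.exp ((m + c) * t)) ≤ W := by
    have h3 : -(C * Real.exp (m * t)) ≤ Real.exp (-c * t) * W := by
      linarith [(abs_le.1 h1).1]
    have h4 := mul_le_mul_of_nonneg_right h3 (Real.exp_pos (c * t)).le
    have e1 : Real.exp (-c * t) * W * Real.exp (c * t) = W := by
      rw [mul_right_comm, ← Real.exp_add]; simp
    have e2 : Real.exp (m * t) * Real.exp (c * t) = Real.exp ((m + c) * t) := by
      rw [← Real.exp_add, add_mul]
    rw [e1, neg_mul, mul_assoc, e2] at h4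
    exact h4
  have hsq : D ^ 2 * Real.exp (2 * γ * t) ≤ φ₂ t ^ 2 := by
    have e : Real.exp (2 * γ * t) = Real.exp (γ * t) ^ 2 := by
      rw [sq, ← Real.exp_add]
      congr 1
      ring
    rw [e, ← mul_pow]
    exact pow_le_pow_left₀ (by positivity) h2 2
  rw [le_div_iff₀ (pow_pos (h₂.pos_φ t) 2)]
  refine le_trans ?_ hWlow
  rw [neg_mul, neg_le_neg_iff]
  have e3 : Real.exp ((m + c) * t)
      = Real.exp ((m + c - 2 * γ) * t) * Real.exp (2 * γ * t) := by
    rw [← Real.exp_add]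
    congr 1
    ring
  calc C * Real.exp ((m + c) * t)
      = C / D ^ 2 * Real.exp ((m + c - 2 * γ) * t) * (D ^ 2 * Real.exp (2 * γ * t)) := by
        rw [e3]; field_simp
    _ ≤ _ := mul_le_mul_of_nonneg_left hsq (by positivity)

/-- If the first components have the same decay rate, then their ratio, or its inverse, converges
at `-∞`. -/
theorem ratio_tendsto_of_same_rate (hr : 0 < r) (hb : 0 < b)
    (h₁ : IsWaveProfile r b c φ₁ dφ₁ θ₁ dθ₁) (h₂ : IsWaveProfile r b c φ₂ dφ₂ θ₂ dθ₂) {L : ℝ}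
    (hL : 0 < L) (hL₁ : Tendsto (fun t => dφ₁ t / φ₁ t) atBot (𝓝 L))
    (hL₂ : Tendsto (fun t => dφ₂ t / φ₂ t) atBot (𝓝 L)) :
    (∃ Λ, 0 ≤ Λ ∧ Tendsto (fun t => φ₁ t / φ₂ t) atBot (𝓝 Λ)) ∨
      ∃ Λ, 0 ≤ Λ ∧ Tendsto (fun t => φ₂ t / φ₁ t) atBot (𝓝 Λ) := by
  have hc := h₁.speed_pos hb
  obtain ⟨δ, hδ, hδm⟩ := exists_between (lt_min hL hc)
  have hδL := hδm.trans_le (min_le_left _ _)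
  have hδc := hδm.trans_le (min_le_right _ _)
  obtain ⟨G₁, hG₁, hg₁⟩ := h₁.exists_exp_bound hb hL₁ hδ hδL hδc
  obtain ⟨G₂, hG₂, hg₂⟩ := h₂.exists_exp_bound hb hL₂ hδ hδL hδc
  -- The loss `ε` in the rates must satisfy `4ε < δ`, since the final exponent is `δ - 4ε`. The
  -- exponent `m` of the Wronskian's derivative must be nonzero for integration; it depends on `ε`,
  -- so one of two candidates works.
  obtain ⟨ε, hε, hεδ, hm⟩ : ∃ ε, 0 < ε ∧ 4 * ε < δ ∧ 2 * (L - ε) - c + δ ≠ 0 := by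
    by_cases h : 2 * (L - δ / 8) - c + δ = 0
    · exact ⟨δ / 16, by linarith, by linarith, fun h' => by linarith⟩
    · exact ⟨δ / 8, by linarith, by linarith, h⟩
  set m := 2 * (L - ε) - c + δ with hmdef
  obtain ⟨A₁, hA₁, ha₁⟩ := exp_bound_of_log_deriv h₁.deriv_φ h₁.pos_φ hL₁ (by linarith : L - ε < L)
  obtain ⟨A₂, hA₂, ha₂⟩ := exp_bound_of_log_deriv h₂.deriv_φ h₂.pos_φ hL₂ (by linarith : L - ε < L)
  obtain ⟨D₁, hD₁, hd₁⟩ :=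
    exp_lower_bound_of_log_deriv h₁.deriv_φ h₁.pos_φ hL₁ (by linarith : L < L + ε)
  obtain ⟨D₂, hD₂, hd₂⟩ :=
    exp_lower_bound_of_log_deriv h₂.deriv_φ h₂.pos_φ hL₂ (by linarith : L < L + ε)
  obtain ⟨T, hT⟩ := eventually_atBot.1 ((hg₁.and hg₂).and (ha₁.and ha₂))
  obtain ⟨K, hK⟩ := exists_const_of_exp_deriv_bound (C := A₁ * A₂ * ((1 + r) * (G₁ + G₂))) (T := T)
    hm (hasDerivAt_wronskian h₁ h₂) (fun t ht => by
      obtain ⟨⟨⟨p1, q1⟩, p2, q2⟩, s1, s2⟩ := hT t ht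
      have e0 : Real.exp (m * t) = Real.exp (-c * t) * (Real.exp ((L - ε) * t) *
          Real.exp ((L - ε) * t) * Real.exp (δ * t)) := by
        rw [← Real.exp_add, ← Real.exp_add, ← Real.exp_add, hmdef]; ring_nf
      have e1 : φ₁ t * φ₂ t ≤ A₁ * Real.exp ((L - ε) * t) * (A₂ * Real.exp ((L - ε) * t)) :=
        mul_le_mul s1 s2 (h₂.pos_φ t).le (by positivity)
      have e2 : |φ₁ t - φ₂ t - r * ((1 - θ₁ t) - (1 - θ₂ t))|
          ≤ (1 + r) * (G₁ + G₂) * Real.exp (δ * t) := by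
        have f1 := mul_le_mul_of_nonneg_left q1 hr.le
        have f2 := mul_le_mul_of_nonneg_left q2 hr.le
        have f3 := mul_nonneg hr.le (sub_nonneg.2 (h₁.θ_le_one t))
        have f4 := mul_nonneg hr.le (sub_nonneg.2 (h₂.θ_le_one t))
        have f5 := h₁.pos_φ t
        have f6 := h₂.pos_φ t
        rw [abs_le]
        constructor <;> nlinarith
      rw [abs_mul, abs_mul, abs_of_pos (Real.exp_pos _),
        abs_of_pos (mul_pos (h₁.pos_φ t) (h₂.pos_φ t)), e0]
      calc _ ≤ Real.exp (-c * t) * (A₁ * Real.exp ((L - ε) * t) * (A₂ * Real.exp ((L - ε) * t)) *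
            ((1 + r) * (G₁ + G₂) * Real.exp (δ * t))) :=
            mul_le_mul_of_nonneg_left (mul_le_mul e1 e2 (abs_nonneg _) (by positivity))
              (Real.exp_pos _).le
        _ = _ := by ring)
  have hγ : 0 < m + c - 2 * (L + ε) := by rw [hmdef]; linarith
  -- Exchanging the profiles changes the sign of the Wronskian, hence of `K`.
  rcases le_total 0 K with hK0 | hK0
  · left
    exact ratio_tendsto_of_wronskian h₁ h₂ hK0 (abs_nonneg _) hD₂ (eventually_atBot.2 ⟨T, hK⟩) hd₂ hγ
  · right
    refine ratio_tendsto_of_wronskian h₂ h₁ (neg_nonneg.2 hK0)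
      (abs_nonneg (A₁ * A₂ * ((1 + r) * (G₁ + G₂)) / m)) hD₁
      (eventually_atBot.2 ⟨T, fun t ht => ?_⟩) hd₁ hγ
    rw [abs_sub_comm]
    convert hK t ht using 2
    ring

/-- A faster decaying first component is negligible at `-∞`. -/
theorem ratio_tendsto_zero_of_rate_lt (h₁ : IsWaveProfile r b c φ₁ dφ₁ θ₁ dθ₁)
    (h₂ : IsWaveProfile r b c φ₂ dφ₂ θ₂ dθ₂) {L₁ L₂ : ℝ} (hlt : L₂ < L₁)
    (hL₁ : Tendsto (fun t => dφ₁ t / φ₁ t) atBot (𝓝 L₁))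
    (hL₂ : Tendsto (fun t => dφ₂ t / φ₂ t) atBot (𝓝 L₂)) :
    Tendsto (fun t => φ₁ t / φ₂ t) atBot (𝓝 0) := by
  obtain ⟨γ₁, hγ₁, hγ₁'⟩ := exists_between hlt
  obtain ⟨γ₂, hγ₂, hγ₂'⟩ := exists_between hγ₁
  obtain ⟨A, hA, ha⟩ := exp_bound_of_log_deriv h₁.deriv_φ h₁.pos_φ hL₁ hγ₁'
  obtain ⟨D, hD, hd⟩ := exp_lower_bound_of_log_deriv h₂.deriv_φ h₂.pos_φ hL₂ hγ₂
  have hlim := (tendsto_exp_mul_atBot (sub_pos.2 hγ₂')).const_mul (A / D)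
  rw [mul_zero] at hlim
  refine squeeze_zero' (Eventually.of_forall fun t => (div_pos (h₁.pos_φ t) (h₂.pos_φ t)).le) ?_ hlim
  filter_upwards [ha, hd] with t h1 h2
  calc φ₁ t / φ₂ t ≤ A * Real.exp (γ₁ * t) / (D * Real.exp (γ₂ * t)) :=
        div_le_div₀ (by positivity) h1 (by positivity) h2
    _ = A / D * Real.exp ((γ₁ - γ₂) * t) := by
        rw [sub_mul, Real.exp_sub]; field_simp

/-- No profile is negligible with respect to another one of the same speed. -/
theorem not_ratio_tendsto_zero (hr : 0 < r) (hb : 0 < b) (h₁ : IsWaveProfile r b c φ₁ dφ₁ θ₁ dθ₁)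
    (h₂ : IsWaveProfile r b c φ₂ dφ₂ θ₂ dθ₂) {L : ℝ}
    (hL₂ : Tendsto (fun t => dφ₂ t / φ₂ t) atBot (𝓝 L)) :
    ¬Tendsto (fun t => φ₁ t / φ₂ t) atBot (𝓝 0) := by
  intro h0
  have hall : ∀ s, ∀ᶠ x in atBot, φ₁ x < φ₂ (x + s) := fun s => by
    filter_upwards [(tendsto_shift_ratio h₂.deriv_φ h₂.pos_φ hL₂ s).sub h0
      |>.eventually_const_lt (by simpa using Real.exp_pos (L * s) :
        (0 : ℝ) < Real.exp (L * s) - 0)] with x hx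
    have := sub_pos.1 hx
    rwa [div_lt_div_iff_of_pos_right (h₂.pos_φ x)] at this
  -- The order holds for all shifts, also very negative ones, and `φ₂` tends to `0` at `-∞`.
  have hle : ∀ s, φ₁ 0 ≤ φ₂ s := fun s => by
    have := (sliding hr hb h₂ h₁ (s₀ := s - 1) (fun s _ => hall s) (by linarith : s - 1 < s) 0).1
    rwa [zero_add] at this
  exact absurd (ge_of_tendsto' h₂.φ_bot hle) (not_le.2 (h₁.pos_φ 0))

theorem translate_of_ratio_tendsto (hr : 0 < r) (hb : 0 < b)
    (h₁ : IsWaveProfile r b c φ₁ dφ₁ θ₁ dθ₁) (h₂ : IsWaveProfile r b c φ₂ dφ₂ θ₂ dθ₂) {L Λ : ℝ}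
    (hL : 0 < L) (hL₁ : Tendsto (fun t => dφ₁ t / φ₁ t) atBot (𝓝 L))
    (hL₂ : Tendsto (fun t => dφ₂ t / φ₂ t) atBot (𝓝 L)) (hΛ : 0 < Λ)
    (hlim : Tendsto (fun t => φ₁ t / φ₂ t) atBot (𝓝 Λ)) :
    ∃ s, ∀ x, φ₂ x = φ₁ (x + s) ∧ θ₂ x = θ₁ (x + s) := by
  -- The ratio `φ₁(x + s)/φ₂(x)` tends to `Λ e^{Ls}`, which equals `1` exactly at this shift.
  set s₀ := -Real.log Λ / L with hs₀
  have hexp : ∀ s, Real.exp (L * s) = Real.exp (L * (s - s₀)) / Λ := fun s => by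
    rw [mul_sub, Real.exp_sub, hs₀, mul_div_cancel₀ _ hL.ne', Real.exp_neg, Real.exp_log hΛ]
    field_simp
  have hfwd : ∀ s, s₀ < s → ∀ᶠ x in atBot, φ₂ x < φ₁ (x + s) := fun s hs => by
    have hl := (tendsto_shift_ratio h₁.deriv_φ h₁.pos_φ hL₁ s).mul hlim
    have hgt : 1 < Real.exp (L * s) * Λ := by
      rw [hexp, div_mul_cancel₀ _ hΛ.ne']
      exact Real.one_lt_exp_iff.2 (mul_pos hL (sub_pos.2 hs))
    filter_upwards [hl.eventually_const_lt hgt] with x hx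
    rw [div_mul_div_cancel₀ (h₁.pos_φ x).ne'] at hx
    exact (one_lt_div (h₂.pos_φ x)).1 hx
  have hbwd : ∀ s, -s₀ < s → ∀ᶠ x in atBot, φ₁ x < φ₂ (x + s) := fun s hs => by
    have hl := tendsto_shift_ratio h₂.deriv_φ h₂.pos_φ hL₂ s
    have hgt : Λ < Real.exp (L * s) := by
      have e : Λ = Real.exp (-(L * s₀)) := by
        rw [hs₀, mul_div_cancel₀ _ hL.ne', neg_neg, Real.exp_log hΛ]
      rw [e]
      exact Real.exp_lt_exp.2 (by nlinarith)
    filter_upwards [(hl.sub hlim).eventually_const_lt (sub_pos.2 hgt)] with x hx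
    have := sub_pos.1 hx
    rwa [div_lt_div_iff_of_pos_right (h₂.pos_φ x)] at this
  have c1 := h₁.continuous_φ
  have c2 := h₂.continuous_φ
  have c3 := h₁.continuous_θ
  have c4 := h₂.continuous_θ
  -- Sliding covers only shifts strictly beyond the critical one; continuity gives the critical
  -- shift itself.
  have hright : ∀ {f : ℝ → ℝ}, Continuous f → ∀ x t : ℝ,
      Tendsto (fun s => f (x + s)) (𝓝[>] t) (𝓝 (f (x + t))) := fun {f} hf x t =>
    ((by fun_prop : Continuous fun s => f (x + s)).tendsto t).mono_left nhdsWithin_le_nhds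
  have hF : ∀ x, φ₂ x ≤ φ₁ (x + s₀) ∧ θ₁ (x + s₀) ≤ θ₂ x := fun x =>
    ⟨ge_of_tendsto (hright c1 x s₀) (eventually_mem_nhdsWithin.mono fun s hs =>
        (sliding hr hb h₁ h₂ hfwd hs x).1),
      le_of_tendsto (hright c3 x s₀) (eventually_mem_nhdsWithin.mono fun s hs =>
        (sliding hr hb h₁ h₂ hfwd hs x).2)⟩
  have hB : ∀ x, φ₁ x ≤ φ₂ (x + -s₀) ∧ θ₂ (x + -s₀) ≤ θ₁ x := fun x =>
    ⟨ge_of_tendsto (hright c2 x (-s₀)) (eventually_mem_nhdsWithin.mono fun s hs =>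
        (sliding hr hb h₂ h₁ hbwd hs x).1),
      le_of_tendsto (hright c4 x (-s₀)) (eventually_mem_nhdsWithin.mono fun s hs =>
        (sliding hr hb h₂ h₁ hbwd hs x).2)⟩
  refine ⟨s₀, fun x => ?_⟩
  have hBx := hB (x + s₀)
  rw [add_neg_cancel_right] at hBx
  exact ⟨le_antisymm (hF x).1 hBx.1, le_antisymm hBx.2 (hF x).2⟩

/-- Profiles of the same speed are translates of each other. -/
theorem translate (hr : 0 < r) (hr1 : r ≠ 1) (hb : 0 < b)
    (h₁ : IsWaveProfile r b c φ₁ dφ₁ θ₁ dθ₁) (h₂ : IsWaveProfile r b c φ₂ dφ₂ θ₂ dθ₂) :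
    ∃ s, ∀ x, φ₂ x = φ₁ (x + s) ∧ θ₂ x = θ₁ (x + s) := by
  obtain ⟨L₁, hL₁, hz₁⟩ := h₁.exists_decay_rate hr hr1 hb
  obtain ⟨L₂, hL₂, hz₂⟩ := h₂.exists_decay_rate hr hr1 hb
  rcases lt_trichotomy L₁ L₂ with hlt | rfl | hlt
  · exact absurd (ratio_tendsto_zero_of_rate_lt h₂ h₁ hlt hz₂ hz₁)
      (not_ratio_tendsto_zero hr hb h₂ h₁ hz₁)
  · rcases ratio_tendsto_of_same_rate hr hb h₁ h₂ hL₁ hz₁ hz₂ with ⟨Λ, hΛ, hlim⟩ | ⟨Λ, hΛ, hlim⟩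
    · rcases hΛ.eq_or_lt with rfl | hpos
      · exact absurd hlim (not_ratio_tendsto_zero hr hb h₁ h₂ hz₂)
      · exact translate_of_ratio_tendsto hr hb h₁ h₂ hL₁ hz₁ hz₂ hpos hlim
    · rcases hΛ.eq_or_lt with rfl | hpos
      · exact absurd hlim (not_ratio_tendsto_zero hr hb h₂ h₁ hz₁)
      · obtain ⟨s, hs⟩ := translate_of_ratio_tendsto hr hb h₂ h₁ hL₁ hz₂ hz₁ hpos hlim
        refine ⟨-s, fun x => ?_⟩
        have := hs (x + -s)
        rw [neg_add_cancel_right] at this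
        exact ⟨this.1.symm, this.2.symm⟩
  · exact absurd (ratio_tendsto_zero_of_rate_lt h₁ h₂ hlt hz₁ hz₂)
      (not_ratio_tendsto_zero hr hb h₁ h₂ hz₂)

end IsWaveProfile

/-- For each admissible speed `c` the profiles of monotone wavefronts, in any direction `ν`, are
exactly the translates of one pair `(φ₀, θ₀)`. -/
theorem theorem5 (d : ℕ) (r b c : ℝ) (hr : 0 < r) (hr1 : r ≠ 1) (hb : 0 < b)
    (hc : IsAdmissibleSpeed d r b c) :
    ∃ φ₀ θ₀ : ℝ → ℝ, ∀ ν : EuclideanSpace ℝ (Fin d), ‖ν‖ = 1 → ∀ φ θ : ℝ → ℝ,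
      IsMonotoneWavefront d r b c ν φ θ ↔
        ∃ s : ℝ, ∀ ξ : ℝ, φ ξ = φ₀ (ξ + s) ∧ θ ξ = θ₀ (ξ + s) := by
  obtain ⟨ν₀, φ₀, θ₀, h₀⟩ := hc
  have hp := h₀.isWaveProfile
  refine ⟨φ₀, θ₀, fun ν hν φ θ => ⟨fun h => hp.translate hr hr1 hb h.isWaveProfile, ?_⟩⟩
  rintro ⟨s, hs⟩
  obtain rfl : φ = fun x => φ₀ (x + s) := funext fun x => (hs x).1
  obtain rfl : θ = fun x => θ₀ (x + s) := funext fun x => (hs x).2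
  exact (hp.shift s).isMonotoneWavefront hν
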